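/- **Setting.** Let $n\ge 1$, $p\in(0,0.001]$, $d=pn$. Let $M$ be an $n\times n$ Bernoulli($p$) random matrix (i.i.d. entries equal to $1$ with probability $p$ and to $0$ with probability $1-p$), $\|\cdot\|$ the Euclidean norm, $\|\cdot\|_\infty$ the sup norm, and $x_A$ the coordinate projection of $x\in\mathbb R^n$ onto $A\subset\{1,\dots,n\}$. For $x\in\mathbb R^n$ fix a permutation $\sigma_x$ such that $x_i^*:=|x_{\sigma_x(i)}|$, $1\le i\le n$, is non-increasing. *The constant $C_0$.* Consider the following property of a number $C_0\ge 1$: for all $n$, all $p\in(0,1/2)$, all $A\subset\{1,\dots,n\}$ and all $x\in\mathbb R^n$ with $x_A\ne 0$ and $\|x_A\|_\infty\le C_0^{-1}\sqrt p\,\|x_A\|$ one has $$\mathbb P\Big(\|Mx\|\le \frac{\sqrt{pn}}{3\sqrt2\,C_0}\|x_A\|\Big)\le e^{-3n},$$ and moreover, if $\lambda:=\sqrt p\,\|x_A\|/(3C_0)\le 1/3$, then $\sup_{c\in\mathbb R}\mathbb P\big(|\sum_j\delta_jx_j-c|\le\lambda\big)\le e^{-8}$ for independent Bernoulli($p$)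 variables $\delta_1,\dots,\delta_n$. *Indices.* Let $\ell_0=\lfloor pn/(4\ln(1/p))\rfloor$ and let $s_0$ be the positive integer with $\ell_0^{s_0-1}\le 1/(64p)<\ell_0^{s_0}$. Put $n_0=2$, $n_j=30\,\ell_0^{j-1}$ for $1\le j\le s_0$, $n_{s_0+1}=\lfloor 1/(64p)\rfloor$ if $\lfloor 1/(64p)\rfloor\ge 15n_{s_0}$ and $n_{s_0+1}=n_{s_0}$ otherwise, $n_{s_0+2}=\lfloor\sqrt{n/p}\rfloor$, $n_{s_0+3}=\lfloor rn\rfloor$. *Steep vectors* (with a parameter $C_\tau>0$). $\mathcal T_0=\{x: x_1^*>6d\,x_2^*\}$; for $1\le j\le s_0+1$, $\mathcal T_{1j}$ is the set of $x\notin\mathcal T_0\cup\bigcup_{1\le i<j}\mathcal T_{1i}$ with $x^*_{n_{j-1}}>6d\,x^*_{n_j}$; $\mathcal T_1=\bigcup_{j=1}^{s_0+1}\mathcal T_{1j}$; for $k=2,3$, $\mathcal T_k$ is the set of $x\notin\bigcup_{i<k}\mathcal T_i$ with $x^*_{n_{s_0+k-1}}>C_\tau\sqrt d\,x^*_{n_{s_0+k}}$.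 Let $\mathcal T=\mathcal T_0\cup\mathcal T_1\cup\mathcal T_2\cup\mathcal T_3$. *$\mathcal R$-vectors.* Let $\Upsilon_n(r)=\{x\in\mathbb R^n: x^*_{\lfloor rn\rfloor}=1\}$ (empty if $\lfloor rn\rfloor=0$), and let $\mathcal{AC}(\rho)$ be the set of $x$ for which there is $\lambda\in\mathbb R$ with $|\lambda|=x^*_{\lfloor rn\rfloor}$ and $|\{i:|x_i-\lambda|\le\rho|\lambda|\}|>n-\lfloor rn\rfloor$. For an integer $k$ with $n_{s_0+1}<k\le n/\ln^2 d$ write $y=x_{\sigma_x(\{k,\dots,n\})}$ and let $$\mathcal R_k^1=\Big\{x\in(\Upsilon_n(r)\setminus\mathcal T)\cap\mathcal{AC}(\rho):\ \frac{\|y\|}{\|y\|_\infty}\ge\frac{C_0}{\sqrt p},\ \sqrt{n/2}\le\|y\|\le C_\tau\sqrt{dn}\Big\},$$ $$\mathcal R_k^2=\Big\{x\in\Upsilon_n(r)\setminus\mathcal T:\ \frac{\|y\|}{\|y\|_\infty}\ge\frac{C_0}{\sqrt p},\ \frac{2\sqrt n}{r}\le\|y\|\le C_\tau^2d\sqrt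 n\Big\}.$$ Let $\mathcal R$ be the union of $\mathcal R_k^1\cup\mathcal R_k^2$ over all such $k$. **Theorem.** There is an absolute constant $C_0\ge1$ with the above property such that for every constant $C_\tau>0$ there are $r_0,\rho_0\in(0,1)$ and $C>0$ (depending on nothing but $C_0$ and $C_\tau$) for which the following holds. Let $0<r\le r_0$, $0<\rho\le\rho_0$, let $n\ge1$ and $p\in(0,0.001]$ be such that $d=pn\ge C\ln n$. Then $$\mathbb P\Big(\exists\,x\in\mathcal R:\ \|Mx\|\le\frac{\sqrt p\,n}{12C_0}\Big)\le e^{-2n}+e^{-200pn}.$$ -/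

import Mathlib

open MeasureTheory ProbabilityTheory Matrix

noncomputable section

namespace BernoulliMatrix

/-! ### Vectors: norms, coordinate projections, non-increasing rearrangement -/

/-- The Euclidean norm `‖x‖` of `x ∈ ℝⁿ`. -/
def l2 {n : ℕ} (x : Fin n → ℝ) : ℝ := ‖WithLp.toLp 2 x‖

/-- The coordinate projection `x_A`. Its sup norm `‖x_A‖_∞` is `‖proj A x‖`, the norm that
Mathlib puts on `Fin n → ℝ`; its Euclidean norm is `l2 (proj A x)`. -/
def proj {n : ℕ} (A : Finset (Fin n)) (x : Fin n → ℝ) : Fin n → ℝ :=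
  fun i => if i ∈ A then x i else 0

/-- A fixed permutation `σ_x` that orders the absolute values of the coordinates of `x` in a
non-increasing way. -/
def sigma {n : ℕ} (x : Fin n → ℝ) : Equiv.Perm (Fin n) := Tuple.sort fun i => -|x i|

/-- `rearr x i` is `x*_i = |x_{σ_x(i)}|` for `1 ≤ i ≤ n` (1-based, as usual); the value for the
other `i`, where `x*_i` is not defined, is `0`. -/
def rearr {n : ℕ} (x : Fin n → ℝ) (i : ℕ) : ℝ :=
  if h : 1 ≤ i ∧ i ≤ n then |x (sigma x ⟨i - 1, by omega⟩)| else 0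

/-- The set `σ_x([k, n])` (positions are 1-based, so position `i : Fin n` is number `i + 1`). -/
def tailSet {n : ℕ} (x : Fin n → ℝ) (k : ℕ) : Finset (Fin n) :=
  (Finset.univ.filter fun i : Fin n => k ≤ (i : ℕ) + 1).image (sigma x)

/-! ### The random matrix -/

/-- The law of a row of `n` independent Bernoulli(`p`) variables (`true` is `1`, `false` is `0`). -/
def rowLaw (n : ℕ) (p : unitInterval) : Measure (Fin n → Bool) :=
  Measure.pi fun _ => bernoulliMeasure true false p

/-- The law of an `n × n` Bernoulli(`p`) random matrix: independent rows of independent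
Bernoulli(`p`) entries. It is a measure on a finite set, all of whose subsets are measurable. -/
def matrixLaw (n : ℕ) (p : unitInterval) : Measure (Fin n → Fin n → Bool) :=
  Measure.pi fun _ => rowLaw n p

/-- The real `0/1` matrix of a Boolean array. -/
def toMat {n : ℕ} (M : Fin n → Fin n → Bool) : Matrix (Fin n) (Fin n) ℝ :=
  Matrix.of fun i j => if M i j then 1 else 0

/-- The Lévy concentration function `Q(ξ, t) = sup_c P(|ξ - c| ≤ t)`. -/
def levyQ {Ω : Type*} [MeasurableSpace Ω] (P : Measure Ω) (ξ : Ω → ℝ) (t : ℝ) : ℝ :=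
  ⨆ c : ℝ, P.real {ω | |ξ ω - c| ≤ t}

/-- The property that singles out the absolute constant `C₀` in the definition of `R`-vectors:
`C₀ ≥ 1`, and whenever `0 < p < 1/2`, `x_A ≠ 0` and `‖x_A‖_∞ ≤ C₀⁻¹ √p ‖x_A‖`, the
anti-concentration bound `P(‖Mx‖ ≤ √(pn) ‖x_A‖ / (3√2 C₀)) ≤ e^{-3n}` holds for the Bernoulli(`p`)
matrix `M`, and, if moreover `λ := √p ‖x_A‖ / (3 C₀) ≤ 1/3`, then `Q(∑ δ_j x_j, λ) ≤ e^{-8}` for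
independent Bernoulli(`p`) variables `δ_j`. -/
def IsAnticoncentrationConst (C₀ : ℝ) : Prop :=
  1 ≤ C₀ ∧
  ∀ (n : ℕ) (p : unitInterval), 0 < (p : ℝ) → (p : ℝ) < 1 / 2 →
  ∀ (A : Finset (Fin n)) (x : Fin n → ℝ), proj A x ≠ 0 →
    ‖proj A x‖ ≤ C₀⁻¹ * √(p : ℝ) * l2 (proj A x) →
    (matrixLaw n p).real
        {M | l2 (toMat M *ᵥ x) ≤ √((p : ℝ) * n) / (3 * √2 * C₀) * l2 (proj A x)}
      ≤ Real.exp (-3 * n) ∧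
    (√(p : ℝ) * l2 (proj A x) / (3 * C₀) ≤ 1 / 3 →
      levyQ (rowLaw n p) (fun δ => ∑ j, (if δ j then 1 else 0) * x j)
          (√(p : ℝ) * l2 (proj A x) / (3 * C₀))
        ≤ Real.exp (-8))

/-! ### The parameters `ℓ₀`, `s₀`, `n_j` -/

/-- `ℓ₀ = ⌊pn / (4 ln(1/p))⌋`. -/
def ell0 (n : ℕ) (p : ℝ) : ℕ := ⌊p * n / (4 * Real.log (1 / p))⌋₊

/-- `s₀` is the positive integer with `ℓ₀^(s₀-1) ≤ 1/(64p) < ℓ₀^s₀`, i.e. (for `ℓ₀ ≥ 2` and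
`p ≤ 1/64`) the least `s` with `1/(64p) < ℓ₀^s`. -/
def s0 (n : ℕ) (p : ℝ) : ℕ := sInf {s : ℕ | 1 / (64 * p) < (ell0 n p : ℝ) ^ s}

/-- The indices `n_0 = 2`, `n_j = 30 ℓ₀^(j-1)` for `1 ≤ j ≤ s₀`,
`n_{s₀+1} = ⌊1/(64p)⌋` if this is at least `15 n_{s₀}` and `n_{s₀+1} = n_{s₀}` otherwise,
`n_{s₀+2} = ⌊√(n/p)⌋`, and `n_{s₀+3} = ⌊rn⌋`. -/
def idx (n : ℕ) (p r : ℝ) (j : ℕ) : ℕ :=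
  if j = 0 then 2
  else if j ≤ s0 n p then 30 * ell0 n p ^ (j - 1)
  else if j = s0 n p + 1 then
    (if 15 * (30 * ell0 n p ^ (s0 n p - 1)) ≤ ⌊1 / (64 * p)⌋₊ then ⌊1 / (64 * p)⌋₊
      else 30 * ell0 n p ^ (s0 n p - 1))
  else if j = s0 n p + 2 then ⌊√((n : ℝ) / p)⌋₊
  else ⌊r * n⌋₊

/-! ### Classes of vectors -/

/-- The `r`-normalized vectors `Υ_n(r)`: those with `x*_{⌊rn⌋} = 1`
(there are none if `⌊rn⌋ = 0`). -/
def normalized (n : ℕ) (r : ℝ) : Set (Fin n → ℝ) := {x | rearr x ⌊r * n⌋₊ = 1}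

/-- The almost constant vectors `AC(ρ)`: for some `λ` with `|λ| = x*_{⌊rn⌋}`, more than
`n - ⌊rn⌋` coordinates satisfy `|x_i - λ| ≤ ρ |λ|`. -/
def almostConstant (n : ℕ) (r ρ : ℝ) : Set (Fin n → ℝ) :=
  {x | ∃ c : ℝ, |c| = rearr x ⌊r * n⌋₊ ∧
    (n : ℤ) - ⌊r * n⌋₊ < (Finset.univ.filter fun i : Fin n => |x i - c| ≤ ρ * |c|).card}

/-- `T_0 = {x : x*_1 > 6d x*_2}`, where `d = pn`. -/
def steep0 (n : ℕ) (p : ℝ) : Set (Fin n → ℝ) :=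
  {x | 6 * (p * n) * rearr x 2 < rearr x 1}

/-- `T_{1j}`, `1 ≤ j ≤ s₀+1`: the vectors in none of `T_0`, `T_{1i}` (`1 ≤ i < j`), with
`x*_{n_{j-1}} > 6d x*_{n_j}` (recall `n_0 = 2`). -/
def steep1j (n : ℕ) (p r : ℝ) (j : ℕ) : Set (Fin n → ℝ) :=
  {x | x ∉ steep0 n p ∧ (∀ i, 1 ≤ i → ∀ _ : i < j, x ∉ steep1j n p r i) ∧
    6 * (p * n) * rearr x (idx n p r j) < rearr x (idx n p r (j - 1))}
termination_by j

/-- `T_1`, the union of the `T_{1j}`, `1 ≤ j ≤ s₀+1`. -/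
def steep1 (n : ℕ) (p r : ℝ) : Set (Fin n → ℝ) :=
  {x | ∃ j, 1 ≤ j ∧ j ≤ s0 n p + 1 ∧ x ∈ steep1j n p r j}

/-- `T_2`: the vectors outside `T_0 ∪ T_1` with `x*_{n_{s₀+1}} > C_τ √d x*_{n_{s₀+2}}`. -/
def steep2 (n : ℕ) (p r Cτ : ℝ) : Set (Fin n → ℝ) :=
  {x | x ∉ steep0 n p ∪ steep1 n p r ∧
    Cτ * √(p * n) * rearr x (idx n p r (s0 n p + 2)) < rearr x (idx n p r (s0 n p + 1))}

/-- `T_3`: the vectors outside `T_0 ∪ T_1 ∪ T_2` with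
`x*_{n_{s₀+2}} > C_τ √d x*_{n_{s₀+3}}`. -/
def steep3 (n : ℕ) (p r Cτ : ℝ) : Set (Fin n → ℝ) :=
  {x | x ∉ steep0 n p ∪ steep1 n p r ∪ steep2 n p r Cτ ∧
    Cτ * √(p * n) * rearr x (idx n p r (s0 n p + 3)) < rearr x (idx n p r (s0 n p + 2))}

/-- The class `T` of steep vectors. -/
def steep (n : ℕ) (p r Cτ : ℝ) : Set (Fin n → ℝ) :=
  steep0 n p ∪ steep1 n p r ∪ steep2 n p r Cτ ∪ steep3 n p r Cτ

/-- The class `R_k^1`. -/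
def R1 (n : ℕ) (p r ρ C₀ Cτ : ℝ) (k : ℕ) : Set (Fin n → ℝ) :=
  {x | x ∈ (normalized n r \ steep n p r Cτ) ∩ almostConstant n r ρ ∧
    C₀ / √p ≤ l2 (proj (tailSet x k) x) / ‖proj (tailSet x k) x‖ ∧
    √((n : ℝ) / 2) ≤ l2 (proj (tailSet x k) x) ∧
    l2 (proj (tailSet x k) x) ≤ Cτ * √(p * n * n)}

/-- The class `R_k^2`. -/
def R2 (n : ℕ) (p r C₀ Cτ : ℝ) (k : ℕ) : Set (Fin n → ℝ) :=
  {x | x ∈ normalized n r \ steep n p r Cτ ∧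
    C₀ / √p ≤ l2 (proj (tailSet x k) x) / ‖proj (tailSet x k) x‖ ∧
    2 * √(n : ℝ) / r ≤ l2 (proj (tailSet x k) x) ∧
    l2 (proj (tailSet x k) x) ≤ Cτ ^ 2 * (p * n) * √(n : ℝ)}

/-- The class of `R`-vectors: the union of `R_k^1 ∪ R_k^2` over the integers `k` with
`n_{s₀+1} < k ≤ n / ln² d`, where `d = pn`. -/
def RVectors (n : ℕ) (p r ρ C₀ Cτ : ℝ) : Set (Fin n → ℝ) :=
  {x | ∃ k : ℕ, idx n p r (s0 n p + 1) < k ∧ (k : ℝ) ≤ n / Real.log (p * n) ^ 2 ∧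
    x ∈ R1 n p r ρ C₀ Cτ k ∪ R2 n p r C₀ Cτ k}

end BernoulliMatrix

end

open BernoulliMatrix

namespace BernoulliMatrix

/-! ### Generalities on the Bernoulli laws -/

/-! The theorem follows from a union bound over a random-free net, with a small ball estimate at
each net point.

Small ball: if `x` is spread on a set `A` at scale `lam`, a Fourier argument gives `P(|∑ δ_j x_j -
c| ≤ lam) ≤ e^{-s}` with `s` as large as desired, and tensorizing over the rows bounds `P(‖Mx‖² ≤ n
lam²/2)` by `e^{(1-s/2)n}` (`exists_smallBall`). With `s = 60` this is `e^{-29n}`.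

Net: an `R`-vector has a center `c ∈ {0, 1, -1}`, from which few coordinates are far, and an integer
scale `τ` comparable to `‖y‖/√n` (`exists_scale_of_mem_RVectors`). It is rounded to `c + ετz` with
`z` integral and `ε = 1/(16 C₀)`. Rounding coordinate by coordinate against the error accumulated so
far gives `‖M(x - x')‖² ≤ (ετ)² · #ones(M)` (`exists_int_rounding`), so a bound on the number of
ones, which fails with probability at most `e^{-200pn}`, replaces any bound on the operator norm.

Entropy: the vectors `z` that occur satisfy `∑ log(1 + |z_i|) ≤ 8n`, and at most `4^n e^{16n}`
integer vectors do (`exists_finset_logSum_le`). The bulk and the tail cost `7n`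
(`sum_log_two_add_le`). The fewer than `k` largest coordinates cost at most `n`, because
non-steepness limits their growth by powers of `6d` (`sum_log_compl_tailSet_le`). -/

instance isProbabilityMeasure_rowLaw (n : ℕ) (p : unitInterval) :
    IsProbabilityMeasure (rowLaw n p) := by
  unfold rowLaw; infer_instance

instance isProbabilityMeasure_matrixLaw (n : ℕ) (p : unitInterval) :
    IsProbabilityMeasure (matrixLaw n p) := by
  unfold matrixLaw; infer_instance

lemma measureReal_le_integral {Ω : Type*} [Finite Ω] [MeasurableSpace Ω]
    [MeasurableSingletonClass Ω] (μ : Measure Ω) [IsFiniteMeasure μ] {s : Set Ω} {f : Ω → ℝ}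
    (hf : ∀ ω, 0 ≤ f ω) (hs : ∀ ω ∈ s, 1 ≤ f ω) : μ.real s ≤ ∫ ω, f ω ∂μ := by
  have h := mul_meas_ge_le_integral_of_nonneg (μ := μ) (f := f) (Filter.Eventually.of_forall hf)
    .of_finite 1
  rw [one_mul] at h
  exact (measureReal_mono (fun ω hω => hs ω hω)).trans h

lemma integral_rowLaw_prod {𝕜 : Type*} [RCLike 𝕜] (n : ℕ) (p : unitInterval)
    (f : Fin n → Bool → 𝕜) :
    ∫ δ, ∏ j, f j (δ j) ∂(rowLaw n p) =
      ∏ j, ((p : ℝ) • f j true + (1 - (p : ℝ)) • f j false) := by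
  rw [rowLaw, integral_fintype_prod_eq_prod]
  simp_rw [integral_bernoulliMeasure]

lemma integral_matrixLaw_prod (n : ℕ) (p : unitInterval) (f : (Fin n → Bool) → ℝ) :
    ∫ M, ∏ i, f (M i) ∂(matrixLaw n p) = (∫ δ, f δ ∂(rowLaw n p)) ^ n := by
  rw [matrixLaw, integral_fintype_prod_eq_pow, Fintype.card_fin]

/-- The random variable `∑ δ_j x_j`. -/
def rowSum {n : ℕ} (x : Fin n → ℝ) (δ : Fin n → Bool) : ℝ :=
  ∑ j, (if δ j then 1 else 0) * x j

lemma toMat_mulVec_apply {n : ℕ} (M : Fin n → Fin n → Bool) (x : Fin n → ℝ) (i : Fin n) :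
    (toMat M *ᵥ x) i = rowSum x (M i) := rfl

lemma l2_nonneg {n : ℕ} (x : Fin n → ℝ) : 0 ≤ l2 x := norm_nonneg _

lemma l2_sq {n : ℕ} (x : Fin n → ℝ) : l2 x ^ 2 = ∑ i, x i ^ 2 := by
  rw [l2, EuclideanSpace.norm_sq_eq]
  simp

lemma l2_proj_sq {n : ℕ} (A : Finset (Fin n)) (x : Fin n → ℝ) :
    l2 (proj A x) ^ 2 = ∑ i ∈ A, x i ^ 2 := by
  rw [l2_sq]
  simp [proj, ite_pow, Finset.sum_ite_mem]

lemma l2_add_le {n : ℕ} (x y : Fin n → ℝ) : l2 (x + y) ≤ l2 x + l2 y := by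
  simpa [l2] using norm_add_le (WithLp.toLp 2 x) (WithLp.toLp 2 y)

lemma l2_smul {n : ℕ} (c : ℝ) (x : Fin n → ℝ) : l2 (c • x) = |c| * l2 x := by
  simp [l2, norm_smul]

/-! ### Anti-concentration of Bernoulli sums -/

lemma norm_bernoulli_char_sq (p α : ℝ) :
    ‖(p : ℝ) • Complex.exp (α * Complex.I) + (1 - p : ℝ) • (1 : ℂ)‖ ^ 2 =
      1 - 2 * p * (1 - p) * (1 - Real.cos α) := by
  rw [← Complex.normSq_eq_norm_sq, Complex.exp_mul_I, ← Complex.ofReal_cos, ← Complex.ofReal_sin,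
    Complex.normSq_apply]
  simp [-Complex.ofReal_cos, -Complex.ofReal_sin]
  linear_combination p ^ 2 * Real.sin_sq_add_cos_sq α

lemma norm_bernoulli_char_le_one {p : ℝ} (hp0 : 0 ≤ p) (hp1 : p ≤ 1) (α : ℝ) :
    ‖(p : ℝ) • Complex.exp (α * Complex.I) + (1 - p : ℝ) • (1 : ℂ)‖ ≤ 1 := by
  rw [← sq_le_one_iff₀ (norm_nonneg _), norm_bernoulli_char_sq]
  have : 0 ≤ 2 * p * (1 - p) * (1 - Real.cos α) :=
    mul_nonneg (mul_nonneg (by linarith) (by linarith)) (by linarith [Real.cos_le_one α])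
  linarith

/-- Follows from `cos α ≤ 1 - 2α²/π²` and `2p(1 - p) ≥ p`, after squaring. -/
lemma norm_bernoulli_char_le {p : ℝ} (hp0 : 0 ≤ p) (hp1 : p ≤ 1 / 2) {α : ℝ} (hα : |α| ≤ 1) :
    ‖(p : ℝ) • Complex.exp (α * Complex.I) + (1 - p : ℝ) • (1 : ℂ)‖ ≤
      Real.exp (-(p * α ^ 2 / 10)) := by
  have hπ : (1 : ℝ) / 5 ≤ 2 / Real.pi ^ 2 := by
    rw [div_le_div_iff₀ (by norm_num) (by positivity)]
    nlinarith [Real.pi_lt_d2, Real.pi_pos]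
  have hcos : Real.cos α ≤ 1 - 1 / 5 * α ^ 2 :=
    (Real.cos_le_one_sub_mul_cos_sq (hα.trans (by linarith [Real.pi_gt_three]))).trans (by
      nlinarith [mul_le_mul_of_nonneg_right hπ (sq_nonneg α)])
  refine le_of_sq_le_sq ?_ (Real.exp_pos _).le
  rw [norm_bernoulli_char_sq, ← Real.exp_nat_mul]
  have h1 : p * (1 / 5 * α ^ 2) ≤ 2 * p * (1 - p) * (1 - Real.cos α) := by
    have h2 : p ≤ 2 * p * (1 - p) := by nlinarith
    exact mul_le_mul h2 (by linarith) (by positivity) (by nlinarith)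
  have h3 := Real.add_one_le_exp (((2 : ℕ) : ℝ) * -(p * α ^ 2 / 10))
  refine le_trans ?_ h3
  push_cast
  linarith

/-- By independence the characteristic function factorizes; `c` is only a phase, and the factors off
`A` are bounded by `1`. -/
lemma norm_integral_exp_rowSum_le {n : ℕ} {p : unitInterval} (hp1 : (p : ℝ) ≤ 1 / 2)
    {A : Finset (Fin n)} {x : Fin n → ℝ} (c : ℝ) {θ : ℝ} (hθ : ∀ j ∈ A, |θ * x j| ≤ 1) :
    ‖∫ δ, Complex.exp ((θ * (rowSum x δ - c) : ℝ) * Complex.I) ∂(rowLaw n p)‖ ≤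
      Real.exp (-(θ ^ 2 * (p * ∑ j ∈ A, x j ^ 2) / 10)) := by
  have key : ∀ δ : Fin n → Bool, Complex.exp ((θ * (rowSum x δ - c) : ℝ) * Complex.I) =
      Complex.exp ((-(θ * c) : ℝ) * Complex.I) *
        ∏ j, (fun (j : Fin n) (b : Bool) =>
          if b then Complex.exp ((θ * x j : ℝ) * Complex.I) else 1) j (δ j) := by
    intro δ
    have : ∀ j, (if δ j then Complex.exp ((θ * x j : ℝ) * Complex.I) else 1) =
        Complex.exp ((θ * ((if δ j then 1 else 0) * x j) : ℝ) * Complex.I) := by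
      intro j; split_ifs <;> simp
    simp only [this]
    rw [← Complex.exp_sum, ← Complex.exp_add, ← Finset.sum_mul, ← add_mul, ← Complex.ofReal_sum,
      ← Complex.ofReal_add, ← Finset.mul_sum, rowSum]
    ring_nf
  simp_rw [key]
  rw [integral_const_mul, norm_mul, Complex.norm_exp_ofReal_mul_I, one_mul,
    integral_rowLaw_prod n p (fun (j : Fin n) (b : Bool) =>
      if b then Complex.exp ((θ * x j : ℝ) * Complex.I) else 1), norm_prod]
  simp only [if_true, Bool.false_eq_true, if_false]
  rw [← Finset.prod_mul_prod_compl A]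
  have hA : ∏ j ∈ A, ‖(p : ℝ) • Complex.exp ((θ * x j : ℝ) * Complex.I) +
      (1 - (p : ℝ)) • (1 : ℂ)‖ ≤ ∏ j ∈ A, Real.exp (-(p * (θ * x j) ^ 2 / 10)) :=
    Finset.prod_le_prod (fun _ _ => norm_nonneg _) fun j hj =>
      norm_bernoulli_char_le p.2.1 hp1 (hθ j hj)
  have hB : ∏ j ∈ Aᶜ, ‖(p : ℝ) • Complex.exp ((θ * x j : ℝ) * Complex.I) +
      (1 - (p : ℝ)) • (1 : ℂ)‖ ≤ 1 :=
    Finset.prod_le_one (fun _ _ => norm_nonneg _) fun j hj =>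
      norm_bernoulli_char_le_one p.2.1 p.2.2 _
  refine (mul_le_mul hA hB (Finset.prod_nonneg fun _ _ => norm_nonneg _)
    (Finset.prod_nonneg fun _ _ => (Real.exp_pos _).le)).trans ?_
  rw [mul_one, ← Real.exp_sum, Finset.sum_neg_distrib]
  apply le_of_eq
  congr 2
  rw [Finset.mul_sum, Finset.mul_sum, Finset.sum_div]
  exact Finset.sum_congr rfl fun j _ => by ring

/-- A discrete form of Esseen's inequality: for `|s| ≤ lam` all `N` phases are at most `1` in
absolute value, so every cosine is at least `1/2`. The right side thus dominates the indicator of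
`|s| ≤ lam`. -/
lemma quarter_le_normSq_sum_exp {N : ℕ} (hN : 0 < N) {lam s : ℝ} (hl : 0 < lam)
    (hs : |s| ≤ lam) :
    1 ≤ 4 / (N : ℝ) ^ 2 *
      ‖∑ a ∈ Finset.range N, Complex.exp ((a / (N * lam) * s : ℝ) * Complex.I)‖ ^ 2 := by
  have hN' : (0 : ℝ) < N := by exact_mod_cast hN
  have hre : (N : ℝ) / 2 ≤
      ‖∑ a ∈ Finset.range N, Complex.exp ((a / (N * lam) * s : ℝ) * Complex.I)‖ := by
    refine le_trans ?_ (Complex.re_le_norm _)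
    rw [Complex.re_sum]
    simp only [Complex.exp_ofReal_mul_I_re]
    have : ∀ a ∈ Finset.range N, (1 / 2 : ℝ) ≤ Real.cos (a / (N * lam) * s) := by
      intro a ha
      have ha' : (a : ℝ) ≤ N := by exact_mod_cast (Finset.mem_range.1 ha).le
      have h1 : |a / (N * lam) * s| ≤ 1 := by
        rw [abs_mul, abs_of_nonneg (by positivity), div_mul_eq_mul_div,
          div_le_one (by positivity)]
        exact mul_le_mul ha' hs (abs_nonneg _) hN'.le
      have h2 := Real.one_sub_sq_div_two_le_cos (x := a / (N * lam) * s)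
      have h3 := (sq_le_one_iff_abs_le_one _).2 h1
      linarith
    have h := Finset.sum_le_sum this
    simp only [Finset.sum_const, Finset.card_range, nsmul_eq_mul] at h
    linarith
  rw [div_mul_eq_mul_div, le_div_iff₀ (by positivity)]
  nlinarith

/-- The square of the exponential sum expands into `N²` characteristic functions. The diagonal
contributes `N`; off it the frequency lies between `1/(N lam)` and `1/lam` in absolute value, large
enough for decay and small enough for the quadratic bound on `A`. -/
lemma measureReal_rowSum_le {n : ℕ} {p : unitInterval} (hp1 : (p : ℝ) ≤ 1 / 2)
    {A : Finset (Fin n)} {x : Fin n → ℝ} {lam L : ℝ} (hl : 0 < lam)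
    (hA : ∀ j ∈ A, |x j| ≤ lam) (hL : L ^ 2 * lam ^ 2 ≤ p * ∑ j ∈ A, x j ^ 2)
    {N : ℕ} (hN : 0 < N) (c : ℝ) :
    (rowLaw n p).real {δ | |rowSum x δ - c| ≤ lam} ≤
      4 * (1 / N + Real.exp (-(L ^ 2 / (10 * N ^ 2)))) := by
  have hN' : (0 : ℝ) < N := by exact_mod_cast hN
  set F : ℕ → (Fin n → Bool) → ℂ := fun a δ =>
    Complex.exp ((a / (N * lam) * (rowSum x δ - c) : ℝ) * Complex.I) with hF
  set η := Real.exp (-(L ^ 2 / (10 * N ^ 2))) with hη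
  refine (measureReal_le_integral (rowLaw n p)
    (f := fun δ => 4 / (N : ℝ) ^ 2 * ‖∑ a ∈ Finset.range N, F a δ‖ ^ 2)
    (fun δ => by positivity) fun δ hδ => quarter_le_normSq_sum_exp hN hl hδ).trans ?_
  rw [integral_const_mul]
  have hpair : ∀ a ∈ Finset.range N, ∀ b ∈ Finset.range N,
      ‖∫ δ, F a δ * (starRingEnd ℂ) (F b δ) ∂(rowLaw n p)‖ ≤ (if a = b then 1 else 0) + η := by
    intro a ha b hb
    have hab : ∀ δ, F a δ * (starRingEnd ℂ) (F b δ) =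
        Complex.exp ((((a : ℝ) - b) / (N * lam) * (rowSum x δ - c) : ℝ) * Complex.I) := by
      intro δ
      simp only [hF]
      rw [← Complex.exp_conj, ← Complex.exp_add, map_mul, Complex.conj_I, Complex.conj_ofReal]
      congr 1
      push_cast
      ring
    simp_rw [hab]
    by_cases h : a = b
    · subst h
      simp
      positivity
    rw [if_neg h, zero_add]
    have ha' : (a : ℝ) ≤ N := by exact_mod_cast (Finset.mem_range.1 ha).le
    have hb' : (b : ℝ) ≤ N := by exact_mod_cast (Finset.mem_range.1 hb).le
    have ha0 : (0 : ℝ) ≤ a := a.cast_nonneg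
    have hb0 : (0 : ℝ) ≤ b := b.cast_nonneg
    have habs : |(a : ℝ) - b| ≤ N := abs_le.2 ⟨by linarith, by linarith⟩
    have hone : 1 ≤ ((a : ℝ) - b) ^ 2 := by
      have : (1 : ℤ) ≤ ((a : ℤ) - b) ^ 2 := by
        have : ((a : ℤ) - b) ≠ 0 := sub_ne_zero.2 (by exact_mod_cast h)
        have := sq_pos_of_ne_zero this
        omega
      exact_mod_cast this
    refine (norm_integral_exp_rowSum_le (A := A) hp1 c ?_).trans ?_
    · intro j hj
      rw [abs_mul, abs_div, abs_of_pos (by positivity : 0 < (N : ℝ) * lam), div_mul_eq_mul_div,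
        div_le_one (by positivity)]
      exact mul_le_mul habs (hA j hj) (abs_nonneg _) hN'.le
    · rw [hη, Real.exp_le_exp, neg_le_neg_iff, div_le_div_iff₀ (by positivity) (by norm_num),
        div_pow, div_mul_eq_mul_div, div_mul_eq_mul_div,
        le_div_iff₀ (by positivity)]
      have h1 : L ^ 2 * lam ^ 2 ≤ ((a : ℝ) - b) ^ 2 * (p * ∑ j ∈ A, x j ^ 2) :=
        hL.trans (le_mul_of_one_le_left (le_trans (by positivity) hL) hone)
      nlinarith [mul_le_mul_of_nonneg_right h1 (by positivity : 0 ≤ 10 * (N : ℝ) ^ 2)]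
  have hsum : ∫ δ, ‖∑ a ∈ Finset.range N, F a δ‖ ^ 2 ∂(rowLaw n p) ≤ N + N ^ 2 * η := by
    have hC : ((∫ δ, ‖∑ a ∈ Finset.range N, F a δ‖ ^ 2 ∂(rowLaw n p) : ℝ) : ℂ) =
        ∑ a ∈ Finset.range N, ∑ b ∈ Finset.range N,
          ∫ δ, F a δ * (starRingEnd ℂ) (F b δ) ∂(rowLaw n p) := by
      rw [← integral_complex_ofReal]
      simp_rw [← integral_finsetSum _ fun b _ => Integrable.of_finite]
      congr 1
      ext δ
      rw [← Complex.normSq_eq_norm_sq]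
      refine (Complex.mul_conj _).symm.trans ?_
      rw [map_sum, Finset.sum_mul_sum]
    have hn : ∫ δ, ‖∑ a ∈ Finset.range N, F a δ‖ ^ 2 ∂(rowLaw n p) ≤
        ‖((∫ δ, ‖∑ a ∈ Finset.range N, F a δ‖ ^ 2 ∂(rowLaw n p) : ℝ) : ℂ)‖ := by
      rw [Complex.norm_real]; exact le_abs_self _
    refine hn.trans ?_
    rw [hC]
    refine (norm_sum_le _ _).trans ((Finset.sum_le_sum fun a ha =>
      (norm_sum_le _ _).trans (Finset.sum_le_sum fun b hb => hpair a ha b hb)).trans ?_)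
    apply le_of_eq
    simp only [Finset.sum_add_distrib, Finset.sum_ite_eq, Finset.sum_const, Finset.card_range,
      nsmul_eq_mul]
    rw [Finset.sum_congr rfl (g := fun _ => (1 : ℝ)) fun a ha => if_pos ha]
    simp
    ring
  refine (mul_le_mul_of_nonneg_left hsum (by positivity)).trans (le_of_eq ?_)
  field_simp

/-- Anti-concentration: if `|x_j| ≤ lam` on `A` while `√p ‖x_A‖ ≥ L lam` with a large `L`, then
`∑ δ_j x_j` puts little mass on intervals of length `2 lam`. -/
lemma exists_anticoncentration {q : ℝ} (hq : 0 < q) : ∃ L : ℝ, 1 ≤ L ∧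
    ∀ L' : ℝ, L ≤ L' → ∀ (n : ℕ) (p : unitInterval), (p : ℝ) ≤ 1 / 2 →
    ∀ (A : Finset (Fin n)) (x : Fin n → ℝ) (lam : ℝ), 0 < lam → (∀ j ∈ A, |x j| ≤ lam) →
    L' ^ 2 * lam ^ 2 ≤ p * ∑ j ∈ A, x j ^ 2 →
    ∀ c : ℝ, (rowLaw n p).real {δ | |rowSum x δ - c| ≤ lam} ≤ q := by
  obtain ⟨N, hN⟩ := exists_nat_gt (8 / q)
  have hN0 : (0 : ℝ) < N := lt_trans (by positivity) hN
  have hN1 : (1 : ℝ) ≤ N := by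
    have : 0 < N := by exact_mod_cast hN0
    exact_mod_cast this
  refine ⟨10 * N ^ 2, by nlinarith, fun L' hL' n p hp A x lam hl hA hL c => ?_⟩
  refine (measureReal_rowSum_le hp hl hA hL (by exact_mod_cast hN0) c).trans ?_
  have h1 : 1 / (N : ℝ) ≤ q / 8 := by
    rw [div_le_div_iff₀ hN0 (by norm_num)]
    rw [div_lt_iff₀ hq] at hN
    linarith
  have h2 : Real.exp (-(L' ^ 2 / (10 * N ^ 2))) ≤ 1 / N := by
    rw [Real.exp_neg, ← one_div]
    refine one_div_le_one_div_of_le hN0 ?_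
    have h3 : (N : ℝ) ≤ L' ^ 2 / (10 * N ^ 2) := by
      rw [le_div_iff₀ (by positivity)]
      have h4 : (10 * (N : ℝ) ^ 2) ^ 2 ≤ L' ^ 2 := by gcongr
      nlinarith [pow_le_pow_left₀ zero_le_one hN1 3, pow_pos hN0 3]
    linarith [Real.add_one_le_exp (L' ^ 2 / (10 * (N : ℝ) ^ 2))]
  linarith

/-- Tensorization of the anti-concentration of the rows. -/
lemma measureReal_l2_mulVec_le {n : ℕ} {p : unitInterval} {x : Fin n → ℝ} {lam s : ℝ}
    (hl : 0 < lam) (hs : 0 ≤ s)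
    (hx : (rowLaw n p).real {δ | |rowSum x δ| ≤ lam} ≤ Real.exp (-s)) :
    (matrixLaw n p).real {M | l2 (toMat M *ᵥ x) ^ 2 ≤ n * lam ^ 2 / 2} ≤
      Real.exp ((1 - s / 2) * n) := by
  -- The product of `f` over the rows is at least `1` on the event. Its mean on one row is at most
  -- `e^{s/2} e^{-s} + e^{-s/2}`, split according to `|rowSum x δ| ≤ lam`.
  set f : (Fin n → Bool) → ℝ := fun δ => Real.exp (s / 2 - s * rowSum x δ ^ 2 / lam ^ 2) with hf
  have hrow : ∫ δ, f δ ∂(rowLaw n p) ≤ Real.exp (1 - s / 2) := by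
    set S := {δ | |rowSum x δ| ≤ lam}
    have hb : ∀ δ, f δ ≤ Real.exp (s / 2) * S.indicator 1 δ + Real.exp (-(s / 2)) := by
      intro δ
      by_cases h : δ ∈ S
      · rw [Set.indicator_of_mem h, hf]
        have : Real.exp (s / 2 - s * rowSum x δ ^ 2 / lam ^ 2) ≤ Real.exp (s / 2) := by
          rw [Real.exp_le_exp]
          have : 0 ≤ s * rowSum x δ ^ 2 / lam ^ 2 := by positivity
          linarith
        have := Real.exp_pos (-(s / 2))
        simp only [Pi.one_apply, mul_one]
        linarith
      · rw [Set.indicator_of_notMem h, mul_zero, zero_add, hf, Real.exp_le_exp]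
        have h1 : lam < |rowSum x δ| := not_le.1 h
        have h2 : lam ^ 2 ≤ rowSum x δ ^ 2 := by
          rw [← sq_abs (rowSum x δ)]; gcongr
        have h3 : s ≤ s * rowSum x δ ^ 2 / lam ^ 2 := by
          rw [le_div_iff₀ (by positivity)]; gcongr
        linarith
    calc ∫ δ, f δ ∂(rowLaw n p)
        ≤ ∫ δ, (Real.exp (s / 2) * S.indicator 1 δ + Real.exp (-(s / 2))) ∂(rowLaw n p) :=
          integral_mono .of_finite .of_finite hb
      _ = Real.exp (s / 2) * (rowLaw n p).real S + Real.exp (-(s / 2)) := by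
          rw [integral_add .of_finite .of_finite, integral_const_mul,
            integral_indicator_one (Set.toFinite S).measurableSet]
          simp
      _ ≤ Real.exp (s / 2) * Real.exp (-s) + Real.exp (-(s / 2)) := by gcongr
      _ = 2 * Real.exp (-(s / 2)) := by rw [← Real.exp_add]; ring_nf
      _ ≤ Real.exp 1 * Real.exp (-(s / 2)) := by
          gcongr; linarith [Real.add_one_le_exp (1 : ℝ)]
      _ = Real.exp (1 - s / 2) := by rw [← Real.exp_add]; ring_nf
  refine (measureReal_le_integral (matrixLaw n p) (f := fun M => ∏ i, f (M i))
    (fun M => Finset.prod_nonneg fun _ _ => (Real.exp_pos _).le) fun M hM => ?_).trans ?_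
  · rw [hf, ← Real.exp_sum]
    apply Real.one_le_exp
    have hM' : ∑ i, rowSum x (M i) ^ 2 ≤ n * lam ^ 2 / 2 := by
      have : l2 (toMat M *ᵥ x) ^ 2 ≤ n * lam ^ 2 / 2 := hM
      rw [l2_sq] at this
      simpa only [toMat_mulVec_apply] using this
    rw [Finset.sum_sub_distrib, ← Finset.sum_div (f := fun i => s * rowSum x (M i) ^ 2),
      ← Finset.mul_sum]
    simp only [Finset.sum_const, Finset.card_univ, Fintype.card_fin, nsmul_eq_mul]
    rw [sub_nonneg, div_le_iff₀ (by positivity)]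
    nlinarith [mul_le_mul_of_nonneg_left hM' hs]
  · rw [integral_matrixLaw_prod, mul_comm, Real.exp_nat_mul]
    exact pow_le_pow_left₀ (integral_nonneg fun δ => (Real.exp_pos _).le) hrow _

/-- Small ball estimate for `‖Mx‖`, for the vectors `x` that are spread on some set `A`. -/
lemma exists_smallBall {s : ℝ} (hs : 0 ≤ s) : ∃ L : ℝ, 1 ≤ L ∧
    ∀ L' : ℝ, L ≤ L' → ∀ (n : ℕ) (p : unitInterval), (p : ℝ) ≤ 1 / 2 →
    ∀ (A : Finset (Fin n)) (x : Fin n → ℝ) (lam : ℝ), 0 < lam → (∀ j ∈ A, |x j| ≤ lam) →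
    L' ^ 2 * lam ^ 2 ≤ p * ∑ j ∈ A, x j ^ 2 →
    (matrixLaw n p).real {M | l2 (toMat M *ᵥ x) ^ 2 ≤ n * lam ^ 2 / 2} ≤
        Real.exp ((1 - s / 2) * n) ∧
      ∀ c : ℝ, (rowLaw n p).real {δ | |rowSum x δ - c| ≤ lam} ≤ Real.exp (-s) := by
  obtain ⟨L, hL1, hL⟩ := exists_anticoncentration (Real.exp_pos (-s))
  refine ⟨L, hL1, fun L' hL' n p hp A x lam hl hA hx => ?_⟩
  have h := hL L' hL' n p hp A x lam hl hA hx
  exact ⟨measureReal_l2_mulVec_le hl hs (by simpa using h 0), h⟩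

lemma abs_le_norm_proj {n : ℕ} {A : Finset (Fin n)} (x : Fin n → ℝ) {j : Fin n} (hj : j ∈ A) :
    |x j| ≤ ‖proj A x‖ := by
  have := norm_le_pi_norm (proj A x) j
  simpa [proj, hj] using this

/-- With `lam = √p ‖x_A‖ / C₀` both spreading conditions hold at once, the second with equality; the
required radii are a third of those supplied. -/
lemma isAnticoncentrationConst_of_smallBall {C₀ : ℝ} (hC : 1 ≤ C₀)
    (h : ∀ (n : ℕ) (p : unitInterval), (p : ℝ) ≤ 1 / 2 →
      ∀ (A : Finset (Fin n)) (x : Fin n → ℝ) (lam : ℝ), 0 < lam → (∀ j ∈ A, |x j| ≤ lam) →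
      C₀ ^ 2 * lam ^ 2 ≤ p * ∑ j ∈ A, x j ^ 2 →
      (matrixLaw n p).real {M | l2 (toMat M *ᵥ x) ^ 2 ≤ n * lam ^ 2 / 2} ≤ Real.exp (-3 * n) ∧
      ∀ c : ℝ, (rowLaw n p).real {δ | |rowSum x δ - c| ≤ lam} ≤ Real.exp (-8)) :
    IsAnticoncentrationConst C₀ := by
  refine ⟨hC, fun n p hp0 hp1 A x hx hA => ?_⟩
  have hC0 : 0 < C₀ := by linarith
  have hpos : 0 < l2 (proj A x) := by
    have : WithLp.toLp 2 (proj A x) ≠ 0 := fun h0 => hx (by simpa using h0)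
    exact norm_pos_iff.2 this
  have hsp : 0 < √(p : ℝ) := Real.sqrt_pos.2 hp0
  set lam := √(p : ℝ) * l2 (proj A x) / C₀ with hlam
  have hl : 0 < lam := by positivity
  obtain ⟨h1, h2⟩ := h n p hp1.le A x lam hl (fun j hj => (abs_le_norm_proj x hj).trans
      (hA.trans (le_of_eq (by rw [hlam]; field_simp)))) (le_of_eq (by
      rw [hlam, ← l2_proj_sq, div_pow, mul_pow, Real.sq_sqrt hp0.le]; field_simp))
  refine ⟨(measureReal_mono fun M hM => ?_).trans h1, fun _ => ?_⟩
  · have hM' : l2 (toMat M *ᵥ x) ≤ √((p : ℝ) * n) / (3 * √2 * C₀) * l2 (proj A x) := hM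
    have h3 : l2 (toMat M *ᵥ x) ^ 2 ≤
        (√((p : ℝ) * n) / (3 * √2 * C₀) * l2 (proj A x)) ^ 2 :=
      pow_le_pow_left₀ (l2_nonneg _) hM' 2
    refine h3.trans ?_
    rw [hlam, mul_pow, div_pow, div_pow, mul_pow, mul_pow, mul_pow, Real.sq_sqrt (by positivity),
      Real.sq_sqrt (by positivity), Real.sq_sqrt hp0.le]
    rw [div_mul_eq_mul_div, mul_div_assoc', div_div, div_le_div_iff₀ (by positivity) (by positivity)]
    have : 0 ≤ (p : ℝ) * n * l2 (proj A x) ^ 2 * C₀ ^ 2 := by positivity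
    nlinarith
  · refine ciSup_le fun c => (measureReal_mono fun δ hδ => ?_).trans (h2 c)
    have hδ' : |rowSum x δ - c| ≤ √(p : ℝ) * l2 (proj A x) / (3 * C₀) := hδ
    refine hδ'.trans ?_
    rw [hlam]
    exact div_le_div_of_nonneg_left (by positivity) hC0 (by linarith)

/-! ### Rounding to the integer lattice -/

/-- Greedy rounding: floor or ceiling is chosen so that the new error has nonpositive inner product
with the accumulated one. Squared norms then add without cross terms. -/
lemma exists_int_rounding_sum {ι E : Type*} [NormedAddCommGroup E] [InnerProductSpace ℝ E]
    (v : ι → E) (u : ι → ℝ) (s : Finset ι) :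
    ∃ z : ι → ℤ, (∀ i, |(z i : ℝ) - u i| ≤ 1) ∧
      ‖∑ i ∈ s, ((z i : ℝ) - u i) • v i‖ ^ 2 ≤ ∑ i ∈ s, ‖v i‖ ^ 2 := by
  classical
  induction s using Finset.induction_on with
  | empty =>
    exact ⟨fun i => ⌊u i⌋, fun i => abs_le.2 ⟨by linarith [Int.sub_one_lt_floor (u i)],
      by linarith [Int.floor_le (u i)]⟩, by simp⟩
  | insert a s ha ih =>
    obtain ⟨z, hz, hs⟩ := ih
    set w := ∑ i ∈ s, ((z i : ℝ) - u i) • v i with hw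
    obtain ⟨m, hm, hmw⟩ : ∃ m : ℤ, |(m : ℝ) - u a| ≤ 1 ∧
        ((m : ℝ) - u a) * inner ℝ w (v a) ≤ 0 := by
      rcases le_total 0 (inner ℝ w (v a)) with h | h
      · exact ⟨⌊u a⌋, abs_le.2 ⟨by linarith [Int.sub_one_lt_floor (u a)],
          by linarith [Int.floor_le (u a)]⟩,
          mul_nonpos_of_nonpos_of_nonneg (by linarith [Int.floor_le (u a)]) h⟩
      · exact ⟨⌈u a⌉, abs_le.2 ⟨by linarith [Int.le_ceil (u a)],
          by linarith [Int.ceil_lt_add_one (u a)]⟩,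
          mul_nonpos_of_nonneg_of_nonpos (by linarith [Int.le_ceil (u a)]) h⟩
    refine ⟨Function.update z a m, fun i => ?_, ?_⟩
    · by_cases h : i = a
      · subst h; simpa using hm
      · simpa [h] using hz i
    · have hsum : ∑ i ∈ s, ((Function.update z a m i : ℝ) - u i) • v i = w := by
        refine Finset.sum_congr rfl fun i hi => ?_
        rw [Function.update_of_ne (by rintro rfl; exact ha hi)]
      rw [Finset.sum_insert ha, Finset.sum_insert ha, hsum, Function.update_self, add_comm,
        norm_add_sq_real, inner_smul_right, norm_smul, mul_pow, Real.norm_eq_abs]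
      have h1 : |(m : ℝ) - u a| ^ 2 * ‖v a‖ ^ 2 ≤ ‖v a‖ ^ 2 :=
        mul_le_of_le_one_left (sq_nonneg _) (pow_le_one₀ (abs_nonneg _) hm)
      linarith

/-- The number of ones of a Boolean array. -/
def ones {n : ℕ} (M : Fin n → Fin n → Bool) : ℝ := ∑ i, ∑ j, if M i j then 1 else 0

/-- Applied to the columns of `M`, whose squared norms sum to the number of ones. The vector `z`
depends on `M`, which is harmless because the union bound covers every lattice point that may occur.
-/
lemma exists_int_rounding {n : ℕ} (M : Fin n → Fin n → Bool) (u : Fin n → ℝ) :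
    ∃ z : Fin n → ℤ, (∀ i, |(z i : ℝ) - u i| ≤ 1) ∧
      l2 (toMat M *ᵥ fun i => (z i : ℝ) - u i) ^ 2 ≤ ones M := by
  obtain ⟨z, hz, h⟩ := exists_int_rounding_sum
    (fun j => WithLp.toLp 2 fun i => toMat M i j) u Finset.univ
  refine ⟨z, hz, ?_⟩
  have h1 : WithLp.toLp 2 (toMat M *ᵥ fun i => (z i : ℝ) - u i) =
      ∑ j, ((z j : ℝ) - u j) • WithLp.toLp 2 fun i => toMat M i j := by
    ext i
    simp [Matrix.mulVec, dotProduct, mul_comm]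
  rw [l2, h1]
  refine h.trans (le_of_eq ?_)
  simp only [EuclideanSpace.norm_sq_eq]
  rw [ones, Finset.sum_comm]
  simp [toMat, ite_pow]

/-- Exponential Markov with parameter `1`: since `e - 1 ≤ 2`, `E e^{ones} ≤ e^{2pn²}`, whence `202 =
200 + 2`. -/
lemma measureReal_ones_le {n : ℕ} (hn : 1 ≤ n) (p : unitInterval) :
    (matrixLaw n p).real {M | 202 * (p : ℝ) * n ^ 2 ≤ ones M} ≤ Real.exp (-200 * (p * n)) := by
  have hp := p.2.1
  have hn' : (1 : ℝ) ≤ n := by exact_mod_cast hn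
  set g : (Fin n → Bool) → ℝ := fun δ =>
    ∏ j, (fun (_ : Fin n) (b : Bool) => if b then Real.exp 1 else 1) j (δ j) with hg
  have hrow : ∫ δ, g δ ∂(rowLaw n p) ≤ Real.exp (2 * p * n) := by
    rw [hg, integral_rowLaw_prod n p fun (_ : Fin n) (b : Bool) => if b then Real.exp 1 else 1]
    simp only [if_true, Bool.false_eq_true, if_false, Finset.prod_const, Finset.card_univ,
      Fintype.card_fin, smul_eq_mul, mul_one]
    rw [mul_comm (2 * (p : ℝ)), Real.exp_nat_mul]
    refine pow_le_pow_left₀ (by nlinarith [p.2.2, Real.exp_pos 1]) ?_ _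
    refine le_trans ?_ (Real.add_one_le_exp _)
    nlinarith [Real.exp_one_lt_d9]
  have hg0 : ∀ δ, 0 ≤ g δ := fun δ => Finset.prod_nonneg fun j _ => by
    dsimp only; split_ifs <;> positivity
  refine (measureReal_le_integral (matrixLaw n p)
    (f := fun M => Real.exp (-(202 * (p : ℝ) * n ^ 2)) * ∏ i, g (M i))
    (fun M => mul_nonneg (Real.exp_pos _).le (Finset.prod_nonneg fun i _ => hg0 _))
    fun M hM => ?_).trans ?_
  · have : ∏ i, g (M i) = Real.exp (ones M) := by
      rw [ones, Real.exp_sum]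
      refine Finset.prod_congr rfl fun i _ => ?_
      rw [Real.exp_sum]
      refine Finset.prod_congr rfl fun j _ => ?_
      dsimp only
      split_ifs <;> simp
    rw [this, ← Real.exp_add]
    apply Real.one_le_exp
    have : 202 * (p : ℝ) * n ^ 2 ≤ ones M := hM
    linarith
  · rw [integral_const_mul, integral_matrixLaw_prod]
    calc Real.exp (-(202 * (p : ℝ) * n ^ 2)) * (∫ δ, g δ ∂(rowLaw n p)) ^ n
        ≤ Real.exp (-(202 * (p : ℝ) * n ^ 2)) * Real.exp (2 * p * n) ^ n := by
          gcongr
      _ = Real.exp (-200 * (p * n) * n) := by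
          rw [← Real.exp_nat_mul, ← Real.exp_add]; ring_nf
      _ ≤ Real.exp (-200 * (p * n)) := by
          rw [Real.exp_le_exp]
          nlinarith [mul_nonneg hp (by linarith : (0 : ℝ) ≤ n)]

/-! ### Counting lattice points -/

lemma sum_range_inv_sq_le (B : ℕ) :
    ∑ m ∈ Finset.range (B + 1), 1 / (1 + (m : ℝ)) ^ 2 ≤ 2 - 1 / (1 + (B : ℝ)) := by
  induction B with
  | zero => norm_num
  | succ B ih =>
    rw [Finset.sum_range_succ]
    have h : 1 / (1 + ((B + 1 : ℕ) : ℝ)) ^ 2 ≤ 1 / (1 + (B : ℝ)) - 1 / (1 + ((B + 1 : ℕ) : ℝ)) := by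
      push_cast
      rw [div_sub_div _ _ (by positivity) (by positivity),
        div_le_div_iff₀ (by positivity) (by positivity)]
      have : (0 : ℝ) ≤ B := B.cast_nonneg
      nlinarith
    linarith

lemma sum_Icc_inv_sq_le (B : ℕ) :
    ∑ m ∈ Finset.Icc (-(B : ℤ)) B, 1 / (1 + |(m : ℝ)|) ^ 2 ≤ 4 := by
  have hsub : Finset.Icc (-(B : ℤ)) B ⊆
      (Finset.range (B + 1)).image (fun m : ℕ => (m : ℤ)) ∪
        (Finset.range (B + 1)).image (fun m : ℕ => -(m : ℤ)) := by
    intro m hm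
    rw [Finset.mem_Icc] at hm
    simp only [Finset.mem_union, Finset.mem_image, Finset.mem_range]
    rcases le_total 0 m with h | h
    · exact Or.inl ⟨m.toNat, by omega, by omega⟩
    · exact Or.inr ⟨(-m).toNat, by omega, by omega⟩
  have hle := sum_range_inv_sq_le B
  have hpos : (0 : ℝ) ≤ 1 / (1 + (B : ℝ)) := by positivity
  refine (Finset.sum_le_sum_of_subset_of_nonneg hsub fun _ _ _ => by positivity).trans ?_
  have hui := Finset.sum_union_inter (f := fun m : ℤ => 1 / (1 + |(m : ℝ)|) ^ 2)
    (s₁ := (Finset.range (B + 1)).image (fun m : ℕ => (m : ℤ)))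
    (s₂ := (Finset.range (B + 1)).image (fun m : ℕ => -(m : ℤ)))
  have hinter : 0 ≤ ∑ m ∈ (Finset.range (B + 1)).image (fun m : ℕ => (m : ℤ)) ∩
      (Finset.range (B + 1)).image (fun m : ℕ => -(m : ℤ)), 1 / (1 + |(m : ℝ)|) ^ 2 :=
    Finset.sum_nonneg fun _ _ => by positivity
  rw [Finset.sum_image (by intro a _ b _ h; simpa using h),
    Finset.sum_image (by intro a _ b _ h; simpa using h)] at hui
  simp only [Int.cast_natCast, Int.cast_neg, abs_neg, Nat.abs_cast] at hui
  linarith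

/-- There are at most `4 ^ n exp (2 L)` integer vectors with `∑ log (1 + |z_i|) ≤ L`. -/
lemma exists_finset_logSum_le (n : ℕ) (L : ℝ) : ∃ F : Finset (Fin n → ℤ),
    (∀ z, z ∈ F ↔ ∑ i, Real.log (1 + |(z i : ℝ)|) ≤ L) ∧ (F.card : ℝ) ≤ 4 ^ n * Real.exp (2 * L) := by
  classical
  set B : ℕ := ⌈Real.exp L⌉₊
  set G := Fintype.piFinset fun _ : Fin n => Finset.Icc (-(B : ℤ)) B with hG
  refine ⟨G.filter fun z => ∑ i, Real.log (1 + |(z i : ℝ)|) ≤ L, fun z => ?_, ?_⟩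
  · rw [Finset.mem_filter, and_iff_right_iff_imp]
    intro hz
    rw [hG, Fintype.mem_piFinset]
    intro i
    have h1 : Real.log (1 + |(z i : ℝ)|) ≤ L :=
      (Finset.single_le_sum (f := fun i => Real.log (1 + |(z i : ℝ)|))
        (fun i _ => Real.log_nonneg (by linarith [abs_nonneg (z i : ℝ)]))
        (Finset.mem_univ i)).trans hz
    rw [Real.log_le_iff_le_exp (by positivity)] at h1
    have h2 : |(z i : ℝ)| ≤ B := by linarith [Nat.le_ceil (Real.exp L)]
    rw [Finset.mem_Icc, ← abs_le]
    exact_mod_cast h2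
  -- Each counted vector has weight at least `1`, and the total weight over the box factorizes into
  -- one-dimensional sums bounded by `4`.
  · have h : ∀ z ∈ G.filter (fun z => ∑ i, Real.log (1 + |(z i : ℝ)|) ≤ L),
        (1 : ℝ) ≤ Real.exp (2 * L) * ∏ i, 1 / (1 + |(z i : ℝ)|) ^ 2 := by
      intro z hz
      have hz' := (Finset.mem_filter.1 hz).2
      have : ∏ i, 1 / (1 + |(z i : ℝ)|) ^ 2 =
          Real.exp (-(2 * ∑ i, Real.log (1 + |(z i : ℝ)|))) := by
        rw [Finset.mul_sum, ← Finset.sum_neg_distrib, Real.exp_sum]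
        refine Finset.prod_congr rfl fun i _ => ?_
        have hpos : (0 : ℝ) < 1 + |(z i : ℝ)| := by positivity
        rw [Real.exp_neg, ← one_div, two_mul, Real.exp_add, Real.exp_log hpos, sq]
      rw [this, ← Real.exp_add]
      exact Real.one_le_exp (by linarith)
    calc ((G.filter fun z => ∑ i, Real.log (1 + |(z i : ℝ)|) ≤ L).card : ℝ)
        = ∑ z ∈ G.filter (fun z => ∑ i, Real.log (1 + |(z i : ℝ)|) ≤ L), (1 : ℝ) := by simp
      _ ≤ ∑ z ∈ G.filter (fun z => ∑ i, Real.log (1 + |(z i : ℝ)|) ≤ L),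
            Real.exp (2 * L) * ∏ i, 1 / (1 + |(z i : ℝ)|) ^ 2 := Finset.sum_le_sum h
      _ ≤ ∑ z ∈ G, Real.exp (2 * L) * ∏ i, 1 / (1 + |(z i : ℝ)|) ^ 2 :=
          Finset.sum_le_sum_of_subset_of_nonneg (Finset.filter_subset _ _)
            fun _ _ _ => by positivity
      _ = Real.exp (2 * L) * (∑ m ∈ Finset.Icc (-(B : ℤ)) B, 1 / (1 + |(m : ℝ)|) ^ 2) ^ n := by
          rw [← Finset.mul_sum, hG, Finset.sum_pow']
      _ ≤ Real.exp (2 * L) * 4 ^ n := by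
          gcongr
          exact sum_Icc_inv_sq_le B
      _ = 4 ^ n * Real.exp (2 * L) := mul_comm _ _

/-! ### The rearrangement of non-steep vectors -/

lemma rearr_nonneg {n : ℕ} (x : Fin n → ℝ) (i : ℕ) : 0 ≤ rearr x i := by
  unfold rearr; split_ifs <;> positivity

lemma rearr_succ {n : ℕ} (x : Fin n → ℝ) (i : Fin n) : rearr x (i + 1) = |x (sigma x i)| := by
  rw [rearr, dif_pos ⟨by omega, by omega⟩]
  rfl

lemma rearr_le_rearr {n : ℕ} (x : Fin n → ℝ) {i j : ℕ} (hi : 1 ≤ i) (hij : i ≤ j) :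
    rearr x j ≤ rearr x i := by
  by_cases hj : j ≤ n
  · rw [rearr, rearr, dif_pos ⟨hi.trans hij, hj⟩, dif_pos ⟨hi, hij.trans hj⟩]
    have h := Tuple.monotone_sort (fun i => -|x i|) (show (⟨i - 1, by omega⟩ : Fin n) ≤
      ⟨j - 1, by omega⟩ from Fin.mk_le_mk.2 (by omega))
    simpa [sigma] using h
  · rw [rearr, dif_neg fun h => hj h.2]
    exact rearr_nonneg x i

lemma mem_tailSet {n : ℕ} (x : Fin n → ℝ) (k : ℕ) (i : Fin n) :
    sigma x i ∈ tailSet x k ↔ k ≤ (i : ℕ) + 1 := by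
  simp [tailSet]

lemma sum_filter_succ_lt_le {n k : ℕ} {h : ℕ → ℝ} (hh : ∀ i, 0 ≤ h i) :
    ∑ i ∈ Finset.univ.filter (fun i : Fin n => (i : ℕ) + 1 < k), h (i + 1) ≤
      ∑ i ∈ Finset.Ico 1 k, h i := by
  rw [← Finset.sum_image (f := h) (g := fun i : Fin n => (i : ℕ) + 1)
    (by intro a _ b _ hab; simpa [Fin.ext_iff] using hab)]
  refine Finset.sum_le_sum_of_subset_of_nonneg ?_ fun _ _ _ => hh _
  intro i
  simp only [Finset.mem_image, Finset.mem_filter, Finset.mem_univ, true_and, Finset.mem_Ico]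
  rintro ⟨a, ha, rfl⟩
  omega

lemma sum_compl_tailSet_le {n : ℕ} (x : Fin n → ℝ) (k : ℕ) {g : ℝ → ℝ}
    (hg : ∀ t, 0 ≤ t → 0 ≤ g t) :
    ∑ l ∈ (tailSet x k)ᶜ, g |x l| ≤ ∑ i ∈ Finset.Ico 1 k, g (rearr x i) := by
  have h : (tailSet x k)ᶜ =
      (Finset.univ.filter fun i : Fin n => (i : ℕ) + 1 < k).map (sigma x).toEmbedding := by
    ext l
    obtain ⟨i, rfl⟩ := (sigma x).surjective l
    simp [mem_tailSet]
  rw [h, Finset.sum_map]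
  simp only [Equiv.coe_toEmbedding, ← rearr_succ]
  exact sum_filter_succ_lt_le (h := fun i => g (rearr x i)) fun i => hg _ (rearr_nonneg x i)

lemma card_compl_tailSet_le {n : ℕ} (x : Fin n → ℝ) (k : ℕ) :
    ((tailSet x k)ᶜ.card : ℝ) ≤ k := by
  have h := sum_compl_tailSet_le x k (g := fun _ => 1) (fun _ _ => zero_le_one)
  simp only [Finset.sum_const, Nat.card_Ico, nsmul_eq_mul, mul_one] at h
  exact h.trans (by exact_mod_cast Nat.sub_le k 1)

lemma card_rearr_lt_abs_le {n : ℕ} (x : Fin n → ℝ) {m : ℕ} (hm : 1 ≤ m) :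
    (Finset.univ.filter fun i => rearr x m < |x i|).card ≤ m := by
  refine le_trans (Finset.card_le_card (t := (tailSet x m)ᶜ) ?_)
    (by exact_mod_cast card_compl_tailSet_le x m)
  intro l
  obtain ⟨i, rfl⟩ := (sigma x).surjective l
  simp only [Finset.mem_filter, Finset.mem_univ, true_and, Finset.mem_compl, mem_tailSet,
    ← rearr_succ]
  intro h h'
  exact absurd h (not_lt.2 (rearr_le_rearr x hm h'))

lemma rearr_one_le_of_notMem_steep {n : ℕ} {p r Cτ : ℝ} {x : Fin n → ℝ}
    (hx : x ∉ steep n p r Cτ) : rearr x 1 ≤ 6 * (p * n) * rearr x 2 := by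
  by_contra! h
  exact hx (Or.inl (Or.inl (Or.inl h)))

/-- A vector in no `T_{1i}` satisfies automatically the clause of `T_{1j}` that excludes the earlier
classes, so the ratio condition is what fails. -/
lemma rearr_idx_le_of_notMem_steep {n : ℕ} {p r Cτ : ℝ} {x : Fin n → ℝ}
    (hx : x ∉ steep n p r Cτ) {j : ℕ} (hj : j < s0 n p + 1) :
    rearr x (idx n p r j) ≤ 6 * (p * n) * rearr x (idx n p r (j + 1)) := by
  have h0 : x ∉ steep0 n p := fun h => hx (Or.inl (Or.inl (Or.inl h)))
  have h1 : ∀ i, 1 ≤ i → i ≤ s0 n p + 1 → x ∉ steep1j n p r i := fun i hi hi' h =>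
    hx (Or.inl (Or.inl (Or.inr ⟨i, hi, hi', h⟩)))
  by_contra! h
  apply h1 (j + 1) (by omega) (by omega)
  rw [steep1j]
  exact ⟨h0, fun i hi hij => h1 i hi (by omega), by simpa using h⟩

lemma rearr_idx_last_le_of_notMem_steep {n : ℕ} {p r Cτ : ℝ} (hC : 0 ≤ Cτ) (hp : 0 ≤ p)
    {x : Fin n → ℝ} (hx : x ∉ steep n p r Cτ) :
    rearr x (idx n p r (s0 n p + 1)) ≤ Cτ ^ 2 * (p * n) * rearr x ⌊r * n⌋₊ := by
  have h0 : x ∉ steep0 n p ∪ steep1 n p r := fun h => hx (Or.inl (Or.inl h))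
  have h2 : x ∉ steep2 n p r Cτ := fun h => hx (Or.inl (Or.inr h))
  have h3 : x ∉ steep3 n p r Cτ := fun h => hx (Or.inr h)
  have e2 : rearr x (idx n p r (s0 n p + 1)) ≤
      Cτ * √(p * n) * rearr x (idx n p r (s0 n p + 2)) := by
    by_contra! h
    exact h2 ⟨h0, h⟩
  have e3 : rearr x (idx n p r (s0 n p + 2)) ≤
      Cτ * √(p * n) * rearr x (idx n p r (s0 n p + 3)) := by
    by_contra! h
    exact h3 ⟨fun h' => h'.elim h0 h2, h⟩
  have e4 : idx n p r (s0 n p + 3) = ⌊r * n⌋₊ := by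
    rw [idx, if_neg (by omega), if_neg (by omega), if_neg (by omega), if_neg (by omega)]
  rw [e4] at e3
  have hpn : 0 ≤ p * n := by positivity
  calc _ ≤ Cτ * √(p * n) * (Cτ * √(p * n) * rearr x ⌊r * n⌋₊) := e2.trans (by gcongr)
    _ = Cτ ^ 2 * √(p * n) ^ 2 * rearr x ⌊r * n⌋₊ := by ring
    _ = _ := by rw [Real.sq_sqrt hpn]

lemma rearr_idx_le_pow {n : ℕ} {p r Cτ : ℝ} (hC : 0 ≤ Cτ) (hp : 0 ≤ p)
    {x : Fin n → ℝ} (hx : x ∉ steep n p r Cτ) (hx1 : x ∈ normalized n r)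
    {m j : ℕ} (hj : j + m = s0 n p + 1) :
    rearr x (idx n p r j) ≤ (6 * (p * n)) ^ m * (Cτ ^ 2 * (p * n)) := by
  induction m generalizing j with
  | zero =>
    have h := rearr_idx_last_le_of_notMem_steep hC hp hx
    rw [show rearr x ⌊r * n⌋₊ = 1 from hx1, mul_one] at h
    rw [show j = s0 n p + 1 by omega]
    simpa using h
  | succ m ih =>
    have h1 := rearr_idx_le_of_notMem_steep hx (j := j) (by omega)
    have h2 := ih (j := j + 1) (by omega)
    calc _ ≤ 6 * (p * n) * ((6 * (p * n)) ^ m * (Cτ ^ 2 * (p * n))) := h1.trans (by gcongr)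
      _ = _ := by ring

lemma idx_pos {n : ℕ} {p r : ℝ} (hl : 2 ≤ ell0 n p) {j : ℕ} (hj : j < s0 n p + 2) :
    1 ≤ idx n p r j := by
  have hpow : ∀ m, 0 < ell0 n p ^ m := fun m => pow_pos (by omega) m
  have := hpow (j - 1)
  have := hpow (s0 n p - 1)
  unfold idx
  split_ifs <;> omega

/-- Each index `n_j` beyond `i` costs one factor `6d`, and position `1` costs one more through
`T_0`. Writing the exponent as a count of indices allows the sum over `i` to be exchanged with the
sum over `j`. -/
lemma log_one_add_rearr_le {n : ℕ} {p r Cτ : ℝ} (hC : 0 ≤ Cτ) (hp : 0 ≤ p)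
    (hl : 2 ≤ ell0 n p) (hd : 1 ≤ p * n) {x : Fin n → ℝ} (hx : x ∉ steep n p r Cτ)
    (hx1 : x ∈ normalized n r) {i : ℕ} (hi : 1 ≤ i) :
    Real.log (1 + rearr x i) ≤ Real.log (1 + Cτ ^ 2 * (p * n)) +
      ((if i = 1 then 1 else 0) +
        ∑ j ∈ Finset.range (s0 n p + 2), if i < idx n p r j then 1 else 0) *
        Real.log (6 * (p * n)) := by
  have hd6 : 1 ≤ 6 * (p * n) := by linarith
  have hD : 0 ≤ Cτ ^ 2 * (p * n) := by positivity
  suffices h : ∃ m : ℕ, (m : ℝ) ≤ (if i = 1 then 1 else 0) +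
      ∑ j ∈ Finset.range (s0 n p + 2), (if i < idx n p r j then (1 : ℝ) else 0) ∧
      rearr x i ≤ (6 * (p * n)) ^ m * (Cτ ^ 2 * (p * n)) by
    obtain ⟨m, hm, hle⟩ := h
    have h1 : 1 + rearr x i ≤ (1 + Cτ ^ 2 * (p * n)) * (6 * (p * n)) ^ m := by
      have := one_le_pow₀ hd6 (n := m)
      nlinarith
    calc Real.log (1 + rearr x i)
        ≤ Real.log ((1 + Cτ ^ 2 * (p * n)) * (6 * (p * n)) ^ m) :=
          Real.log_le_log (by linarith [rearr_nonneg x i]) h1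
      _ = Real.log (1 + Cτ ^ 2 * (p * n)) + m * Real.log (6 * (p * n)) := by
          rw [Real.log_mul (by positivity) (by positivity), Real.log_pow]
      _ ≤ _ := by
          have := Real.log_nonneg hd6
          gcongr
  have hcount : ∀ i, 2 ≤ i → ∃ m : ℕ,
      (m : ℝ) ≤ ∑ j ∈ Finset.range (s0 n p + 2), (if i < idx n p r j then (1 : ℝ) else 0) ∧
      rearr x i ≤ (6 * (p * n)) ^ m * (Cτ ^ 2 * (p * n)) := by
    intro i hi
    -- For the largest `j` with `n_j ≤ i`, the `s₀ + 1 - j` later indices all exceed `i`.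
    set J := (Finset.range (s0 n p + 2)).filter fun j => idx n p r j ≤ i
    have hJ : J.Nonempty := ⟨0, by simp [J, idx, hi]⟩
    have hmem := Finset.max'_mem J hJ
    set j := J.max' hJ
    obtain ⟨hj1, hj2⟩ := Finset.mem_filter.1 hmem
    rw [Finset.mem_range] at hj1
    have hpos : 1 ≤ idx n p r j := idx_pos hl hj1
    refine ⟨s0 n p + 1 - j, ?_, (rearr_le_rearr x hpos hj2).trans
      (rearr_idx_le_pow hC hp hx hx1 (by omega))⟩
    rw [Finset.sum_boole]
    have : Finset.Ico (j + 1) (s0 n p + 2) ⊆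
        (Finset.range (s0 n p + 2)).filter fun j => i < idx n p r j := by
      intro l hl
      rw [Finset.mem_Ico] at hl
      rw [Finset.mem_filter, Finset.mem_range]
      refine ⟨hl.2, ?_⟩
      by_contra! h
      have := J.le_max' l (Finset.mem_filter.2 ⟨Finset.mem_range.2 hl.2, h⟩)
      omega
    have := Finset.card_le_card this
    rw [Nat.card_Ico] at this
    exact_mod_cast (by omega : s0 n p + 1 - j ≤ _)
  rcases eq_or_lt_of_le hi with rfl | hi
  · obtain ⟨m, hm, hle⟩ := hcount 2 le_rfl
    refine ⟨m + 1, ?_, (rearr_one_le_of_notMem_steep hx).trans ?_⟩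
    · push_cast
      rw [add_comm]
      gcongr
      refine hm.trans (Finset.sum_le_sum fun j _ => ?_)
      split_ifs <;> first | omega | norm_num
    · calc _ ≤ 6 * (p * n) * ((6 * (p * n)) ^ m * (Cτ ^ 2 * (p * n))) := by gcongr
        _ = _ := by ring
  · obtain ⟨m, hm, hle⟩ := hcount i hi
    exact ⟨m, by rw [if_neg (by omega), zero_add]; exact hm, hle⟩

lemma ell0_pow_le {n : ℕ} {p : ℝ} (hp : 0 < p) (hp1 : p ≤ 0.001) :
    (ell0 n p : ℝ) ^ (s0 n p - 1) ≤ 1 / (64 * p) := by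
  -- If `s₀ = 0`, for instance as the default infimum of the empty set, the power is `1` and `p ≤
  -- 0.001` suffices.
  rcases Nat.eq_zero_or_pos (s0 n p) with h | h
  · rw [h, Nat.zero_sub, pow_zero, le_div_iff₀ (by positivity)]
    norm_num at hp1 ⊢
    linarith
  · have : s0 n p - 1 ∉ {s : ℕ | 1 / (64 * p) < (ell0 n p : ℝ) ^ s} :=
      Nat.notMem_of_lt_sInf (by unfold s0 at h ⊢; omega)
    exact not_lt.1 this

lemma geom_sum_le_two_mul {b : ℕ} (hb : 2 ≤ b) (s : ℕ) :
    ∑ j ∈ Finset.range s, b ^ j ≤ 2 * b ^ (s - 1) := by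
  induction s with
  | zero => simp
  | succ s ih =>
    rw [Finset.sum_range_succ]
    rcases Nat.eq_zero_or_pos s with rfl | h
    · simp
    · obtain ⟨t, rfl⟩ : ∃ t, s = t + 1 := ⟨s - 1, by omega⟩
      simp only [Nat.add_sub_cancel] at ih ⊢
      nlinarith [pow_succ b t, Nat.mul_le_mul_left (b ^ t) hb]

/-- The middle indices form a geometric sum dominated by its last term, at most `60/(64p)`; the last
index is at most `30/(64p)` and `n_0 = 2 ≤ 0.002/p`. -/
lemma sum_idx_le {n : ℕ} {p r : ℝ} (hp : 0 < p) (hp1 : p ≤ 0.001) (hl : 2 ≤ ell0 n p) :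
    ∑ j ∈ Finset.range (s0 n p + 2), (idx n p r j : ℝ) ≤ 2 / p := by
  have hpow := ell0_pow_le (n := n) hp hp1
  have h0 : (idx n p r 0 : ℝ) = 2 := by simp [idx]
  have hlast : (idx n p r (s0 n p + 1) : ℝ) ≤ 30 * (1 / (64 * p)) := by
    rw [idx, if_neg (by omega), if_neg (by omega), if_pos rfl]
    split_ifs
    · refine (Nat.floor_le (by positivity)).trans ?_
      have : 0 < 1 / (64 * p) := by positivity
      linarith
    · push_cast
      linarith
  have hmid : ∑ j ∈ Finset.range (s0 n p), (idx n p r (j + 1) : ℝ) ≤ 60 * (1 / (64 * p)) := by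
    have h1 : ∀ j ∈ Finset.range (s0 n p), (idx n p r (j + 1) : ℝ) =
        30 * ((ell0 n p ^ j : ℕ) : ℝ) := by
      intro j hj
      rw [Finset.mem_range] at hj
      rw [idx, if_neg (by omega), if_pos (by omega)]
      push_cast
      simp
    rw [Finset.sum_congr rfl h1, ← Finset.mul_sum, ← Nat.cast_sum]
    have h2 : ((∑ j ∈ Finset.range (s0 n p), ell0 n p ^ j : ℕ) : ℝ) ≤
        2 * (ell0 n p : ℝ) ^ (s0 n p - 1) := by
      exact_mod_cast geom_sum_le_two_mul hl (s0 n p)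
    linarith
  rw [Finset.sum_range_succ, Finset.sum_range_succ', h0]
  have h3 : 2 ≤ 0.002 * (1 / p) := by
    rw [mul_one_div, le_div_iff₀ hp]
    norm_num at hp1 ⊢
    linarith
  have h4 : 1 / (64 * p) = 1 / 64 * (1 / p) := by field_simp
  rw [h4] at hlast hmid
  have h5 : 2 / p = 2 * (1 / p) := by ring
  have h6 : 0 < 1 / p := by positivity
  rw [h5]
  linarith

/-- The logarithmic size of the large coordinates of a normalized non-steep vector. -/
lemma sum_log_compl_tailSet_le {n : ℕ} {p r Cτ : ℝ} (hC : 0 ≤ Cτ) (hp : 0 < p)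
    (hp1 : p ≤ 0.001) (hl : 2 ≤ ell0 n p) (hd : 1 ≤ p * n) {x : Fin n → ℝ}
    (hx : x ∉ steep n p r Cτ) (hx1 : x ∈ normalized n r) (k : ℕ) :
    ∑ l ∈ (tailSet x k)ᶜ, Real.log (1 + |x l|) ≤
      k * Real.log (1 + Cτ ^ 2 * (p * n)) + (1 + 2 / p) * Real.log (6 * (p * n)) := by
  have hlog6 : 0 ≤ Real.log (6 * (p * n)) := Real.log_nonneg (by linarith)
  have hlogD : 0 ≤ Real.log (1 + Cτ ^ 2 * (p * n)) :=
    Real.log_nonneg (by linarith [(by positivity : 0 ≤ Cτ ^ 2 * (p * n))])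
  refine (sum_compl_tailSet_le x k (g := fun t => Real.log (1 + t))
    fun t ht => Real.log_nonneg (by linarith)).trans ?_
  refine (Finset.sum_le_sum fun i hi =>
    log_one_add_rearr_le hC hp.le hl hd hx hx1 (Finset.mem_Ico.1 hi).1).trans ?_
  rw [Finset.sum_add_distrib, ← Finset.sum_mul, Finset.sum_add_distrib, Finset.sum_comm]
  have h1 : ∑ i ∈ Finset.Ico 1 k, (if i = 1 then (1 : ℝ) else 0) ≤ 1 := by
    rw [Finset.sum_ite_eq']
    split_ifs <;> norm_num
  have h2 : ∑ j ∈ Finset.range (s0 n p + 2), ∑ i ∈ Finset.Ico 1 k,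
      (if i < idx n p r j then (1 : ℝ) else 0) ≤ 2 / p := by
    refine (Finset.sum_le_sum fun j _ => ?_).trans (sum_idx_le (r := r) hp hp1 hl)
    rw [Finset.sum_boole]
    have : (Finset.Ico 1 k).filter (fun i => i < idx n p r j) ⊆ Finset.range (idx n p r j) := by
      intro i hi
      exact Finset.mem_range.2 (Finset.mem_filter.1 hi).2
    have := Finset.card_le_card this
    rw [Finset.card_range] at this
    exact_mod_cast this
  have h3 : ∑ i ∈ Finset.Ico 1 k, Real.log (1 + Cτ ^ 2 * (p * n)) ≤
      k * Real.log (1 + Cτ ^ 2 * (p * n)) := by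
    rw [Finset.sum_const, Nat.card_Ico, nsmul_eq_mul]
    gcongr
    omega
  have h4 := mul_le_mul_of_nonneg_right (add_le_add h1 h2) hlog6
  linarith

/-! ### Approximation of `R`-vectors -/

/-- Split at `u = 1/ε²`. The constant will be paid only on the small set `S`, the quadratic term by
the Euclidean norm of the tail. -/
lemma log_two_add_le {ε u : ℝ} (hε : 0 < ε) (hu : 0 ≤ u) :
    Real.log (2 + u) ≤ 1 + Real.log (2 + 1 / ε ^ 2) + ε ^ 2 * u ^ 2 := by
  have h0 : 0 ≤ Real.log (2 + 1 / ε ^ 2) :=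
    Real.log_nonneg (by linarith [(by positivity : 0 ≤ 1 / ε ^ 2)])
  rcases le_total u (1 / ε ^ 2) with h | h
  · have h1 : Real.log (2 + u) ≤ Real.log (2 + 1 / ε ^ 2) :=
      Real.log_le_log (by linarith) (by linarith)
    have : 0 ≤ ε ^ 2 * u ^ 2 := by positivity
    linarith
  · have h1 := Real.log_le_sub_one_of_pos (by linarith : 0 < 2 + u)
    rw [div_le_iff₀ (by positivity)] at h
    nlinarith

lemma log_three_le : Real.log 3 ≤ 2 := by
  have := Real.log_le_sub_one_of_pos (by norm_num : (0 : ℝ) < 3)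
  linarith

/-- The logarithmic size of a vector that is nearly constant off a small set `S`, whose part on
`Y` is controlled in the Euclidean norm, and whose part off `Y` has a small logarithmic size. -/
lemma sum_log_two_add_le {n : ℕ} {x : Fin n → ℝ} {c ε τ r H : ℝ} (hc : |c| ≤ 1) (hε : 0 < ε)
    (hε1 : ε ≤ 1) (hτ : 1 ≤ τ) {S Y : Finset (Fin n)} (hS : (S.card : ℝ) ≤ r * n)
    (hr : r * (1 + Real.log (2 + 1 / ε ^ 2)) ≤ 1) (hxS : ∀ i, i ∉ S → |x i - c| ≤ ε * τ)
    (hY : ∑ i ∈ Y, x i ^ 2 ≤ τ ^ 2 * n)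
    (hH : Yᶜ.card * Real.log (3 / ε) + ∑ i ∈ Yᶜ, Real.log (1 + |x i|) ≤ H) :
    ∑ i, Real.log (2 + |(x i - c) / (ε * τ)|) ≤ 7 * n + H := by
  classical
  set A := 1 + Real.log (2 + 1 / ε ^ 2) with hA
  have hA0 : 0 ≤ A := by
    have : 0 ≤ Real.log (2 + 1 / ε ^ 2) :=
      Real.log_nonneg (by linarith [(by positivity : 0 ≤ 1 / ε ^ 2)])
    linarith
  have hlog3 := log_three_le
  have hlog30 : 0 ≤ Real.log 3 := Real.log_nonneg (by norm_num)
  have hlogε : 0 ≤ Real.log (3 / ε) :=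
    Real.log_nonneg (by rw [le_div_iff₀ hε]; linarith)
  have hετ : 0 < ε * τ := by positivity
  -- The budget `7n`: `log 3 ≤ 2` everywhere, `A` on at most `rn` coordinates with `rA ≤ 1`, and
  -- `4n` from the quadratic term on `Y`.
  have hpt : ∀ i, Real.log (2 + |(x i - c) / (ε * τ)|) ≤ Real.log 3 + (if i ∈ S then A else 0) +
      (if i ∈ Y then 2 * (x i ^ 2 + 1) / τ ^ 2 else 0) +
      (if i ∈ Yᶜ then Real.log (3 / ε) + Real.log (1 + |x i|) else 0) := by
    intro i
    have hu := abs_nonneg ((x i - c) / (ε * τ))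
    by_cases hiY : i ∈ Y
    · have hiY' : i ∉ Yᶜ := by simpa using hiY
      rw [if_pos hiY, if_neg hiY', add_zero]
      have h2 : 0 ≤ 2 * (x i ^ 2 + 1) / τ ^ 2 := by positivity
      by_cases hiS : i ∈ S
      · rw [if_pos hiS]
        have h1 := log_two_add_le hε hu
        have h3 : ε ^ 2 * |(x i - c) / (ε * τ)| ^ 2 ≤ 2 * (x i ^ 2 + 1) / τ ^ 2 := by
          rw [sq_abs, div_pow, mul_pow, mul_div_assoc', le_div_iff₀ (by positivity),
            mul_div_mul_left _ _ (by positivity), div_mul_cancel₀ _ (by positivity)]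
          have : c ^ 2 ≤ 1 := (sq_le_one_iff_abs_le_one _).2 hc
          nlinarith [sq_nonneg (x i + c)]
        linarith
      · rw [if_neg hiS, add_zero]
        have h1 : |(x i - c) / (ε * τ)| ≤ 1 := by
          rw [abs_div, abs_of_pos hετ, div_le_one hετ]
          exact hxS i hiS
        have : Real.log (2 + |(x i - c) / (ε * τ)|) ≤ Real.log 3 :=
          Real.log_le_log (by linarith) (by linarith)
        linarith
    · have hiY' : i ∈ Yᶜ := by simpa using hiY
      rw [if_neg hiY, if_pos hiY', add_zero]
      have h1 : 2 + |(x i - c) / (ε * τ)| ≤ 3 / ε * (1 + |x i|) := by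
        have h2 : |(x i - c) / (ε * τ)| ≤ (1 + |x i|) / ε := by
          rw [abs_div, abs_of_pos hετ, div_le_div_iff₀ hετ hε]
          have h3 : |x i - c| ≤ 1 + |x i| := (abs_sub _ _).trans (by linarith)
          nlinarith [mul_le_mul_of_nonneg_right h3 hε.le,
            mul_nonneg (by positivity : 0 ≤ 1 + |x i|) hε.le]
        have h4 : 2 ≤ 2 * ((1 + |x i|) / ε) := by
          have : 1 ≤ (1 + |x i|) / ε := by
            rw [le_div_iff₀ hε]; linarith [abs_nonneg (x i)]
          linarith
        calc _ ≤ 2 * ((1 + |x i|) / ε) + (1 + |x i|) / ε := add_le_add h4 h2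
          _ = _ := by ring
      have h5 : Real.log (2 + |(x i - c) / (ε * τ)|) ≤
          Real.log (3 / ε) + Real.log (1 + |x i|) := by
        rw [← Real.log_mul (by positivity) (by positivity)]
        exact Real.log_le_log (by linarith) h1
      have : 0 ≤ if i ∈ S then A else 0 := by split_ifs <;> linarith
      linarith
  refine (Finset.sum_le_sum fun i _ => hpt i).trans ?_
  simp only [Finset.sum_add_distrib, Finset.sum_ite_mem, Finset.univ_inter, Finset.sum_const,
    Finset.card_univ, Fintype.card_fin, nsmul_eq_mul]
  have h1 : (S.card : ℝ) * A ≤ n := by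
    calc (S.card : ℝ) * A ≤ r * n * A := by gcongr
      _ = r * A * n := by ring
      _ ≤ 1 * n := by gcongr
      _ = n := one_mul _
  have h2 : ∑ i ∈ Y, 2 * (x i ^ 2 + 1) / τ ^ 2 ≤ 4 * (n : ℝ) := by
    rw [← Finset.sum_div, ← Finset.mul_sum, Finset.sum_add_distrib, div_le_iff₀ (by positivity)]
    have hcard : (Y.card : ℝ) ≤ n := by
      have := Finset.card_le_univ Y
      rw [Fintype.card_fin] at this
      exact_mod_cast this
    simp only [Finset.sum_const, nsmul_eq_mul, mul_one]
    have : (n : ℝ) ≤ n * τ ^ 2 := le_mul_of_one_le_right n.cast_nonneg (one_le_pow₀ hτ)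
    linarith
  have h3 : (n : ℝ) * Real.log 3 ≤ n * 2 := by gcongr
  linarith

/-- The vector is spread on `A` at the scale `lam`. -/
def SpreadOn {n : ℕ} (p L lam : ℝ) (A : Finset (Fin n)) (x : Fin n → ℝ) : Prop :=
  (∀ j ∈ A, |x j| ≤ lam) ∧ L ^ 2 * lam ^ 2 ≤ p * ∑ j ∈ A, x j ^ 2

/-- Rounding of a spread vector to a shifted lattice, adapted to a matrix with few ones. -/
lemma exists_lattice_approx {n : ℕ} {p C₀ c τ : ℝ} (hC : 10 ≤ C₀) (hp : 0 ≤ p)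
    (hd : 1 ≤ p * n) (hτ : 1 ≤ τ) {A : Finset (Fin n)} {x : Fin n → ℝ}
    (hA : ∀ j ∈ A, |x j| ≤ √(p * n) * τ / C₀) (hx : 0.16 * τ ^ 2 * n ≤ ∑ j ∈ A, x j ^ 2)
    {M : Fin n → Fin n → Bool} (hM : ones M ≤ 202 * p * n ^ 2)
    (hMx : l2 (toMat M *ᵥ x) ≤ √p * n / (12 * C₀)) :
    ∃ z : Fin n → ℤ,
      (∀ i, |(z i : ℝ) - (x i - c) / (1 / (16 * C₀) * τ)| ≤ 1) ∧
      SpreadOn p (C₀ / 10) (2 * τ * √(p * n) / C₀) A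
        (fun i => c + 1 / (16 * C₀) * τ * z i) ∧
      l2 (toMat M *ᵥ fun i => c + 1 / (16 * C₀) * τ * z i) ^ 2 ≤
        n * (2 * τ * √(p * n) / C₀) ^ 2 / 2 := by
  have hC0 : 0 < C₀ := by linarith
  have hτ0 : 0 < τ := by linarith
  have hsd : 1 ≤ √(p * n) := Real.one_le_sqrt.2 hd
  set η := 1 / (16 * C₀) * τ with hη
  have hη0 : 0 < η := by positivity
  have hη' : η * (16 * C₀) = τ := by rw [hη]; field_simp
  have hηle : η ≤ τ / 160 := by
    rw [le_div_iff₀ (by norm_num)]; nlinarith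
  obtain ⟨z, hz, hMz⟩ := exists_int_rounding M fun i => (x i - c) / η
  have hdiff : ∀ i, c + η * z i = x i + η * ((z i : ℝ) - (x i - c) / η) := by
    intro i; field_simp; ring
  refine ⟨z, hz, ⟨fun j hj => ?_, ?_⟩, ?_⟩
  · show |c + η * z j| ≤ _
    rw [hdiff]
    have h1 : |η * ((z j : ℝ) - (x j - c) / η)| ≤ η := by
      rw [abs_mul, abs_of_pos hη0]
      exact mul_le_of_le_one_right hη0.le (hz j)
    have h2 : η ≤ √(p * n) * τ / C₀ := by
      rw [le_div_iff₀ hC0]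
      nlinarith
    calc _ ≤ |x j| + |η * ((z j : ℝ) - (x j - c) / η)| := abs_add_le _ _
      _ ≤ √(p * n) * τ / C₀ + √(p * n) * τ / C₀ := add_le_add (hA j hj) (h1.trans h2)
      _ = _ := by ring
  -- The mesh `η ≤ τ/160` leaves at least `0.04 τ² n` of the mass, exactly what the spread constant
  -- `C₀/10` requires at this scale.
  · have h1 : ∑ j ∈ A, x j ^ 2 ≤ 2 * ∑ j ∈ A, (c + η * z j) ^ 2 + 2 * (n * η ^ 2) := by
      have hpt : ∀ j ∈ A, x j ^ 2 ≤ 2 * (c + η * z j) ^ 2 + 2 * η ^ 2 := by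
        intro j _
        have h2 : (η * ((z j : ℝ) - (x j - c) / η)) ^ 2 ≤ η ^ 2 := by
          rw [mul_pow]
          exact mul_le_of_le_one_right (sq_nonneg _) ((sq_le_one_iff_abs_le_one _).2 (hz j))
        rw [hdiff]
        nlinarith [sq_nonneg (x j + 2 * (η * ((z j : ℝ) - (x j - c) / η)))]
      refine (Finset.sum_le_sum hpt).trans ?_
      rw [Finset.sum_add_distrib, ← Finset.mul_sum, Finset.sum_const, nsmul_eq_mul]
      have hcard : (A.card : ℝ) ≤ n := by
        have := Finset.card_le_univ A
        rw [Fintype.card_fin] at this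
        exact_mod_cast this
      nlinarith [mul_le_mul_of_nonneg_right hcard (sq_nonneg η)]
    have h3 : η ^ 2 ≤ τ ^ 2 / 160 ^ 2 := by
      rw [← div_pow]; gcongr
    have h4 : 0.04 * τ ^ 2 * n ≤ ∑ j ∈ A, (c + η * z j) ^ 2 := by
      have h5 : (n : ℝ) * η ^ 2 ≤ n * (τ ^ 2 / 160 ^ 2) := by gcongr
      have h6 : 0 ≤ (n : ℝ) * τ ^ 2 := by positivity
      norm_num at hx h5 ⊢
      linarith
    calc (C₀ / 10) ^ 2 * (2 * τ * √(p * n) / C₀) ^ 2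
        = 0.04 * τ ^ 2 * √(p * n) ^ 2 := by field_simp; norm_num
      _ = p * (0.04 * τ ^ 2 * n) := by rw [Real.sq_sqrt (by positivity)]; ring
      _ ≤ _ := by gcongr
  · have hfun : (fun i => c + η * z i) = x + η • fun i => (z i : ℝ) - (x i - c) / η := by
      ext i; simp [hdiff i]
    -- As `202 ≤ 15²`, rounding costs `15/16` in units of `√p n τ / C₀`; with `1/12` from `Mx` the
    -- total is below `1.1`, and `√2` is allowed.
    have h1 : l2 (toMat M *ᵥ fun i => (z i : ℝ) - (x i - c) / η) ≤ 15 * (√p * n) := by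
      refine le_of_sq_le_sq ?_ (by positivity)
      refine (hMz.trans hM).trans ?_
      rw [mul_pow, mul_pow, Real.sq_sqrt hp]
      nlinarith [(by positivity : 0 ≤ p * (n : ℝ) ^ 2)]
    have h2 : l2 (toMat M *ᵥ fun i => c + η * z i) ≤ 1.1 * (√p * n * τ / C₀) := by
      rw [hfun, Matrix.mulVec_add, Matrix.mulVec_smul]
      refine (l2_add_le _ _).trans ?_
      rw [l2_smul, abs_of_pos hη0]
      have h3 : √p * n / (12 * C₀) ≤ 1 / 12 * (√p * n * τ / C₀) := by
        rw [div_le_iff₀ (by positivity)]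
        have : 1 / 12 * (√p * n * τ / C₀) * (12 * C₀) = √p * n * τ := by field_simp
        rw [this]
        exact le_mul_of_one_le_right (by positivity) hτ
      have h4 : η * (15 * (√p * n)) = 15 / 16 * (√p * n * τ / C₀) := by
        rw [hη]; field_simp
      have h5 : 0 ≤ √p * n * τ / C₀ := by positivity
      have h6 := mul_le_mul_of_nonneg_left h1 hη0.le
      norm_num at *
      linarith
    calc l2 (toMat M *ᵥ fun i => c + η * z i) ^ 2 ≤ (1.1 * (√p * n * τ / C₀)) ^ 2 :=
          pow_le_pow_left₀ (l2_nonneg _) h2 2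
      _ ≤ 2 * (√p * n * τ / C₀) ^ 2 := by
          rw [mul_pow]; gcongr; norm_num
      _ = n * (2 * τ * √(p * n) / C₀) ^ 2 / 2 := by
          rw [div_pow, div_pow, mul_pow, mul_pow, mul_pow, mul_pow, Real.sq_sqrt hp,
            Real.sq_sqrt (by positivity)]
          ring

/-- What the proof uses about an `R`-vector: it is nearly constant off a small set, and its tail
is spread at an integer scale `τ`. -/
lemma exists_scale_of_mem_RVectors {n : ℕ} {p r ρ ε C₀ Cτ : ℝ} (hn : 1 ≤ n) (hp : 0 < p)
    (hp1 : p ≤ 1) (hd : 1 ≤ p * n) (hC : 0 < C₀) (hCτ : 0 < Cτ) (hε : 0 < ε) (hε1 : ε ≤ 1)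
    (hr : 0 < r) (hrε : r ≤ 2 * ε) (hρ : ρ ≤ ε) {x : Fin n → ℝ}
    (hx : x ∈ RVectors n p r ρ C₀ Cτ) :
    ∃ (k : ℕ) (c : ℝ) (τ : ℕ) (S : Finset (Fin n)), c ∈ ({0, 1, -1} : Finset ℝ) ∧
      1 ≤ τ ∧ τ ≤ ⌈(1 + Cτ) ^ 2 * n⌉₊ ∧ (k : ℝ) ≤ n / Real.log (p * n) ^ 2 ∧
      x ∉ steep n p r Cτ ∧ x ∈ normalized n r ∧
      (∀ j ∈ tailSet x k, |x j| ≤ √(p * n) * τ / C₀) ∧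
      0.16 * (τ : ℝ) ^ 2 * n ≤ ∑ j ∈ tailSet x k, x j ^ 2 ∧
      ∑ j ∈ tailSet x k, x j ^ 2 ≤ (τ : ℝ) ^ 2 * n ∧
      (S.card : ℝ) ≤ r * n ∧ ∀ i, i ∉ S → |x i - c| ≤ ε * τ := by
  obtain ⟨k, -, hk, hx⟩ := hx
  have hn' : (1 : ℝ) ≤ n := by exact_mod_cast hn
  have hsn : 0 < √(n : ℝ) := Real.sqrt_pos.2 (by linarith)
  have hsp : 0 < √p := Real.sqrt_pos.2 hp
  set y := l2 (proj (tailSet x k) x) with hy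
  have hy0 : 0 ≤ y := l2_nonneg _
  set t := y / √(n : ℝ) with ht
  have hyt : y = t * √(n : ℝ) := by rw [ht]; field_simp
  have ht0 : 0 ≤ t := by positivity
  have hsum : ∑ j ∈ tailSet x k, x j ^ 2 = t ^ 2 * n := by
    rw [← l2_proj_sq, ← hy, hyt, mul_pow, Real.sq_sqrt (by linarith)]
  have hnorm : x ∈ normalized n r := hx.elim (fun h => h.1.1.1) fun h => h.1.1
  have hsteep : x ∉ steep n p r Cτ := hx.elim (fun h => h.1.1.2) fun h => h.1.2
  have hspread : C₀ / √p ≤ y / ‖proj (tailSet x k) x‖ := hx.elim (fun h => h.2.1) fun h => h.2.1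
  have hdn : p * n ≤ n := mul_le_of_le_one_left (by linarith) hp1
  -- The lower bound makes `⌈t⌉ ≤ (5/2) t`, whence `0.16 = (2/5)²`; the upper bound leaves only
  -- `O(n)` scales.
  have hty : 2 / 3 ≤ t ∧ t ≤ (1 + Cτ) ^ 2 * n := by
    rcases hx with ⟨-, -, h1, h2⟩ | ⟨-, -, h1, h2⟩
    · constructor
      · rw [← hy, hyt] at h1
        have h3 : √((n : ℝ) / 2) ^ 2 ≤ (t * √(n : ℝ)) ^ 2 := by gcongr
        rw [mul_pow, Real.sq_sqrt (by linarith), Real.sq_sqrt (by linarith)] at h3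
        have h4 : 1 / 2 ≤ t ^ 2 := by
          by_contra! h
          nlinarith
        nlinarith
      · rw [← hy, hyt, Real.sqrt_mul (by positivity), ← mul_assoc] at h2
        have h3 := le_of_mul_le_mul_right h2 hsn
        have h4 : √(p * n) ≤ n := (Real.sqrt_le_left (by linarith)).2 (by nlinarith)
        nlinarith [Real.sqrt_nonneg (p * n)]
    · constructor
      · rw [← hy, hyt, mul_div_right_comm] at h1
        have h3 := le_of_mul_le_mul_right h1 hsn
        have h4 : 1 ≤ 2 / r := by rw [le_div_iff₀ hr]; linarith
        linarith
      · rw [← hy, hyt] at h2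
        have h3 := le_of_mul_le_mul_right h2 hsn
        have : Cτ ^ 2 * (p * n) ≤ Cτ ^ 2 * n := by gcongr
        nlinarith
  have htτ : t ≤ ⌈t⌉₊ := Nat.le_ceil t
  have hτt : (⌈t⌉₊ : ℝ) ≤ 5 / 2 * t := by
    have := Nat.ceil_lt_add_one ht0
    linarith [hty.1]
  have hτ1 : 1 ≤ ⌈t⌉₊ := Nat.one_le_ceil_iff.2 (by linarith [hty.1])
  have hm : 1 ≤ ⌊r * n⌋₊ := by
    by_contra! h
    have h1 : rearr x ⌊r * n⌋₊ = 1 := hnorm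
    rw [rearr, dif_neg (by omega)] at h1
    norm_num at h1
  have hfl : (⌊r * n⌋₊ : ℝ) ≤ r * n := Nat.floor_le (by positivity)
  have hbound : ∀ j ∈ tailSet x k, |x j| ≤ √(p * n) * (⌈t⌉₊ : ℕ) / C₀ := by
    intro j hj
    refine (abs_le_norm_proj x hj).trans ?_
    -- If the sup norm vanished, the quotient would be `0` by convention, contradicting the lower
    -- bound `C₀/√p`.
    have hpos : 0 < ‖proj (tailSet x k) x‖ := by
      refine (norm_nonneg _).lt_of_ne fun h => ?_
      rw [← h, div_zero] at hspread
      exact absurd hspread (not_le.2 (by positivity))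
    rw [div_le_div_iff₀ hsp hpos] at hspread
    rw [le_div_iff₀ hC, Real.sqrt_mul hp.le, mul_comm]
    refine hspread.trans ?_
    rw [hyt]
    calc t * √(n : ℝ) * √p = √p * √(n : ℝ) * t := by ring
      _ ≤ _ := by gcongr
  suffices h : ∃ (c : ℝ) (S : Finset (Fin n)), c ∈ ({0, 1, -1} : Finset ℝ) ∧
      (S.card : ℝ) ≤ r * n ∧ ∀ i, i ∉ S → |x i - c| ≤ ε * (⌈t⌉₊ : ℕ) by
    obtain ⟨c, S, hc, hS, hxS⟩ := h
    refine ⟨k, c, ⌈t⌉₊, S, hc, hτ1, Nat.ceil_le_ceil hty.2, hk, hsteep, hnorm, hbound, ?_, ?_, hS,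
      hxS⟩
    · rw [hsum]
      gcongr
      norm_num
      nlinarith
    · rw [hsum]; gcongr
  -- For `R_k^1`, `c = ±1` is the almost constant value. For `R_k^2`, `c = 0`: off `S` one has
  -- `|x_i| ≤ 1 ≤ ετ`, because `t ≥ 2/r` and `r ≤ 2ε`.
  rcases hx with ⟨⟨-, c, hc, hcard⟩, -⟩ | ⟨-, -, h1, -⟩
  · have hc1 : |c| = 1 := hc.trans hnorm
    refine ⟨c, (Finset.univ.filter fun i : Fin n => |x i - c| ≤ ρ * |c|)ᶜ, ?_, ?_, ?_⟩
    · rcases (abs_eq zero_le_one).1 hc1 with h | h <;> simp [h]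
    · refine le_trans ?_ hfl
      rw [Finset.card_compl, Fintype.card_fin]
      exact_mod_cast (by omega)
    · intro i hi
      have hi' : |x i - c| ≤ ρ * |c| := by simpa using hi
      rw [hc1, mul_one] at hi'
      have : (1 : ℝ) ≤ (⌈t⌉₊ : ℕ) := by exact_mod_cast hτ1
      nlinarith
  · refine ⟨0, Finset.univ.filter fun i => rearr x ⌊r * n⌋₊ < |x i|, by simp, ?_, ?_⟩
    · exact le_trans (by exact_mod_cast card_rearr_lt_abs_le x hm) hfl
    · intro i hi
      rw [show rearr x ⌊r * n⌋₊ = 1 from hnorm] at hi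
      have hi' : |x i| ≤ 1 := by simpa using hi
      rw [sub_zero]
      rw [← hy, hyt, mul_div_right_comm] at h1
      have h3 := le_of_mul_le_mul_right h1 hsn
      rw [div_le_iff₀ hr] at h3
      have h4 := mul_le_mul_of_nonneg_left hrε ht0
      have h5 := mul_le_mul_of_nonneg_left htτ hε.le
      linarith

/-! ### The net argument -/

lemma measureReal_exists_RVectors_le {n : ℕ} {p : unitInterval} {r ρ C₀ Cτ : ℝ} (hn : 1 ≤ n)
    (hp : 0 < (p : ℝ)) (hp1 : (p : ℝ) ≤ 0.001) (hd : 1 ≤ (p : ℝ) * n) (hC : 10 ≤ C₀)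
    (hCτ : 0 < Cτ) (hr : 0 < r) (hrC : r ≤ 2 * (1 / (16 * C₀))) (hρ : ρ ≤ 1 / (16 * C₀))
    (hrA : r * (1 + Real.log (2 + 1 / (1 / (16 * C₀)) ^ 2)) ≤ 1)
    (hl : 2 ≤ ell0 n p)
    (hhead : ∀ k : ℕ, (k : ℝ) ≤ n / Real.log (p * n) ^ 2 →
      k * Real.log (3 / (1 / (16 * C₀))) + (k * Real.log (1 + Cτ ^ 2 * (p * n)) +
        (1 + 2 / p) * Real.log (6 * (p * n))) ≤ n)
    (hT : 3 * (⌈(1 + Cτ) ^ 2 * n⌉₊ : ℝ) ≤ Real.exp n)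
    (hball : ∀ (A : Finset (Fin n)) (x : Fin n → ℝ) (lam : ℝ), 0 < lam →
      SpreadOn p (C₀ / 10) lam A x →
      (matrixLaw n p).real {M | l2 (toMat M *ᵥ x) ^ 2 ≤ n * lam ^ 2 / 2} ≤
        Real.exp (-29 * n)) :
    (matrixLaw n p).real
        {M | ∃ x ∈ RVectors n (p : ℝ) r ρ C₀ Cτ,
          l2 (toMat M *ᵥ x) ≤ √(p : ℝ) * n / (12 * C₀)}
      ≤ Real.exp (-2 * n) + Real.exp (-200 * ((p : ℝ) * n)) := by
  classical
  have hC0 : 0 < C₀ := by linarith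
  set ε := 1 / (16 * C₀) with hε
  have hε0 : 0 < ε := by positivity
  have hε1 : ε ≤ 1 := by
    rw [hε, div_le_one (by positivity)]; linarith
  set T := ⌈(1 + Cτ) ^ 2 * n⌉₊ with hTdef
  obtain ⟨F, hF, hFcard⟩ := exists_finset_logSum_le n (8 * n)
  -- Spreadness does not involve `M`; placing it in the event makes `E w` empty at the other lattice
  -- points, so the net needs no further selection.
  set E : ℝ × ℕ × (Fin n → ℤ) → Set (Fin n → Fin n → Bool) := fun w =>
    {M | (∃ A, SpreadOn p (C₀ / 10) (2 * w.2.1 * √((p : ℝ) * n) / C₀) A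
        (fun i => w.1 + ε * w.2.1 * w.2.2 i)) ∧
      l2 (toMat M *ᵥ fun i => w.1 + ε * w.2.1 * w.2.2 i) ^ 2 ≤
        n * (2 * w.2.1 * √((p : ℝ) * n) / C₀) ^ 2 / 2} with hE
  set W := ({0, 1, -1} : Finset ℝ) ×ˢ Finset.Icc 1 T ×ˢ F with hW
  have hEle : ∀ w ∈ W, (matrixLaw n p).real (E w) ≤ Real.exp (-29 * n) := by
    rintro ⟨c, τ, z⟩ hw
    have hτ : (1 : ℝ) ≤ τ := by
      have := (Finset.mem_Icc.1 (Finset.mem_product.1 (Finset.mem_product.1 hw).2).1).1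
      exact_mod_cast this
    have hsd : 0 < √((p : ℝ) * n) := Real.sqrt_pos.2 (by linarith)
    by_cases h : ∃ A, SpreadOn p (C₀ / 10) (2 * τ * √((p : ℝ) * n) / C₀) A
        (fun i => c + ε * τ * z i)
    · obtain ⟨A, hA⟩ := h
      have hball' := hball A (fun i => c + ε * τ * z i) (2 * τ * √((p : ℝ) * n) / C₀)
        (by positivity) hA
      refine le_trans (measureReal_mono ?_) hball'
      rintro M ⟨-, hM⟩
      exact hM
    · have : E (c, τ, z) = ∅ := Set.eq_empty_of_forall_notMem fun M hM => h hM.1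
      rw [this, measureReal_empty]
      positivity
  have hincl : {M | ∃ x ∈ RVectors n (p : ℝ) r ρ C₀ Cτ,
      l2 (toMat M *ᵥ x) ≤ √(p : ℝ) * n / (12 * C₀)} ⊆
      (⋃ w ∈ W, E w) ∪ {M | 202 * (p : ℝ) * n ^ 2 ≤ ones M} := by
    rintro M ⟨x, hx, hMx⟩
    rcases le_total (202 * (p : ℝ) * n ^ 2) (ones M) with hM | hM
    · exact Or.inr hM
    left
    obtain ⟨k, c, τ, S, hc, hτ1, hτT, hk, hsteep, hnorm, hsup, hlow, hup, hS, hxS⟩ :=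
      exists_scale_of_mem_RVectors hn hp p.2.2 hd hC0 hCτ hε0 hε1 hr hrC hρ hx
    have hτ1' : (1 : ℝ) ≤ τ := by exact_mod_cast hτ1
    have hc1 : |c| ≤ 1 := by
      simp only [Finset.mem_insert, Finset.mem_singleton] at hc
      rcases hc with rfl | rfl | rfl <;> simp
    obtain ⟨z, hz, hspread, hsmall⟩ :=
      exists_lattice_approx (c := c) hC hp.le hd hτ1' hsup hlow hM hMx
    have hlogε : 0 ≤ Real.log (3 / ε) :=
      Real.log_nonneg (by rw [le_div_iff₀ hε0]; linarith)
    have hH : (tailSet x k)ᶜ.card * Real.log (3 / ε) +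
        ∑ i ∈ (tailSet x k)ᶜ, Real.log (1 + |x i|) ≤ n :=
      (add_le_add (mul_le_mul_of_nonneg_right (card_compl_tailSet_le x k) hlogε)
        (sum_log_compl_tailSet_le hCτ.le hp hp1 hl hd hsteep hnorm k)).trans (hhead k hk)
    have hent := sum_log_two_add_le hc1 hε0 hε1 hτ1' hS hrA hxS hup hH
    have hzF : z ∈ F := by
      rw [hF]
      refine (Finset.sum_le_sum fun i _ => ?_).trans (hent.trans (by linarith))
      refine Real.log_le_log (by positivity) ?_
      have h1 : |(z i : ℝ)| ≤ |(z i : ℝ) - (x i - c) / (ε * τ)| + |(x i - c) / (ε * τ)| := by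
        simpa using abs_add_le ((z i : ℝ) - (x i - c) / (ε * τ)) ((x i - c) / (ε * τ))
      linarith [hz i]
    refine Set.mem_biUnion (x := (c, τ, z)) ?_ ⟨⟨tailSet x k, hspread⟩, hsmall⟩
    simp only [hW, Finset.coe_product, Set.mem_prod, Finset.mem_coe]
    exact ⟨hc, Finset.mem_Icc.2 ⟨hτ1, hτT⟩, hzF⟩
  refine (measureReal_mono hincl).trans ((measureReal_union_le _ _).trans
    (add_le_add ?_ (measureReal_ones_le hn p)))
  refine (measureReal_biUnion_finset_le _ _).trans ((Finset.sum_le_sum hEle).trans ?_)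
  rw [Finset.sum_const, nsmul_eq_mul, hW, Finset.card_product, Finset.card_product, Nat.card_Icc,
    Nat.add_sub_cancel]
  have h3 : ((({0, 1, -1} : Finset ℝ).card : ℕ) : ℝ) ≤ 3 := by
    exact_mod_cast Finset.card_le_three
  have h4 : (4 : ℝ) ^ n ≤ Real.exp (2 * n) := by
    rw [mul_comm, Real.exp_nat_mul]
    gcongr
    have : Real.exp 2 = Real.exp 1 * Real.exp 1 := by rw [← Real.exp_add]; norm_num
    nlinarith [Real.exp_one_gt_d9]
  push_cast
  -- Exponents: `1 + 2 + 16 - 29 = -10`.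
  calc _ ≤ 3 * (T * (4 ^ n * Real.exp (2 * (8 * n)))) * Real.exp (-29 * n) := by gcongr
    _ = 3 * T * (4 ^ n * Real.exp (2 * (8 * n))) * Real.exp (-29 * n) := by ring
    _ ≤ Real.exp n * (Real.exp (2 * n) * Real.exp (2 * (8 * n))) * Real.exp (-29 * n) := by
        gcongr
    _ = Real.exp (-10 * n) := by
        rw [← Real.exp_add, ← Real.exp_add, ← Real.exp_add]; ring_nf
    _ ≤ Real.exp (-2 * n) := by
        rw [Real.exp_le_exp]
        have : (0 : ℝ) ≤ n := n.cast_nonneg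
        linarith

/-! ### Numerical conditions on `n`, `p` and `d` -/

lemma exists_log_threshold (K : ℝ) : ∃ d₀ : ℝ, 1 ≤ d₀ ∧ ∀ d : ℝ, d₀ ≤ d →
    0 < Real.log d ∧ K + Real.log d ≤ Real.log d ^ 2 / 2 ∧ 6 * (2 + Real.log d) ≤ d := by
  have h1 : ∀ᶠ d : ℝ in Filter.atTop, 4 + |K| ≤ Real.log d :=
    Real.tendsto_log_atTop.eventually_ge_atTop _
  have h2 : ∀ᶠ d : ℝ in Filter.atTop, ‖Real.log d‖ ≤ 1 / 12 * ‖id d‖ :=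
    Real.isLittleO_log_id_atTop.def (by norm_num)
  obtain ⟨d₁, hd₁⟩ := Filter.eventually_atTop.1
    (h1.and (h2.and (Filter.eventually_ge_atTop (24 : ℝ))))
  refine ⟨max 1 d₁, le_max_left _ _, fun d hd => ?_⟩
  obtain ⟨h1, h2, h3⟩ := hd₁ d ((le_max_right _ _).trans hd)
  have hK := le_abs_self K
  have hK0 := abs_nonneg K
  rw [Real.norm_eq_abs, Real.norm_eq_abs, id, abs_of_nonneg (by linarith),
    abs_of_nonneg (by linarith)] at h2
  exact ⟨by linarith, by nlinarith, by linarith⟩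

/-- Each half of the budget `n` is met by one threshold: `k ≤ n/log² d` handles the terms with `k`,
and `6(2 + log d) ≤ d = pn` handles the term of order `(log d)/p`. -/
lemma head_le {n : ℕ} {p K a : ℝ} (hp : 0 < p) (hp1 : p ≤ 1) (hd : 1 ≤ p * n)
    {C : ℝ} (hC : 0 ≤ C) (hK : K = Real.log a + Real.log (1 + C))
    (h0 : 0 < Real.log (p * n)) (h1 : K + Real.log (p * n) ≤ Real.log (p * n) ^ 2 / 2)
    (h2 : 6 * (2 + Real.log (p * n)) ≤ p * n) {k : ℕ}
    (hk : (k : ℝ) ≤ n / Real.log (p * n) ^ 2) :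
    k * Real.log a + (k * Real.log (1 + C * (p * n)) + (1 + 2 / p) * Real.log (6 * (p * n))) ≤
      n := by
  set y := Real.log (p * n) with hy
  have hd0 : 0 < p * n := by linarith
  have hlog6 : Real.log 6 ≤ 2 := by
    rw [Real.log_le_iff_le_exp (by norm_num)]
    have : Real.exp 2 = Real.exp 1 * Real.exp 1 := by rw [← Real.exp_add]; norm_num
    nlinarith [Real.exp_one_gt_d9]
  have e1 : Real.log (1 + C * (p * n)) ≤ Real.log (1 + C) + y := by
    rw [hy, ← Real.log_mul (by positivity) hd0.ne']
    exact Real.log_le_log (by positivity) (by nlinarith)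
  have e2 : Real.log (6 * (p * n)) ≤ 2 + y := by
    rw [Real.log_mul (by norm_num) hd0.ne']
    linarith
  have e3 : 1 + 2 / p ≤ 3 / p := by
    have : 1 ≤ 1 / p := by rw [le_div_iff₀ hp]; linarith
    calc 1 + 2 / p ≤ 1 / p + 2 / p := by gcongr
      _ = 3 / p := by ring
  have e4 : (1 + 2 / p) * Real.log (6 * (p * n)) ≤ n / 2 := by
    calc _ ≤ 3 / p * (2 + y) := mul_le_mul e3 e2 (Real.log_nonneg (by linarith)) (by positivity)
      _ = 3 * (2 + y) / p := by ring
      _ ≤ n / 2 := by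
        rw [div_le_div_iff₀ hp (by norm_num)]
        linarith
  have e5 : (k : ℝ) * (K + y) ≤ n / 2 := by
    calc (k : ℝ) * (K + y) ≤ k * (y ^ 2 / 2) := by gcongr
      _ ≤ n / y ^ 2 * (y ^ 2 / 2) := by gcongr
      _ = n / 2 := by field_simp
  have e6 : (k : ℝ) * Real.log (1 + C * (p * n)) ≤ k * (Real.log (1 + C) + y) := by gcongr
  rw [hK] at e5
  linarith

/-- Since `pn ≥ 1`, `log(1/p) ≤ log n`. The value `2` makes the indices `n_j` grow geometrically. -/
lemma two_le_ell0 {n : ℕ} {p : ℝ} (hp : 0 < p) (hp1 : p < 1) (hd : 1 ≤ p * n)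
    (h : 8 * Real.log n ≤ p * n) : 2 ≤ ell0 n p := by
  have h1 : 1 < 1 / p := by rw [lt_div_iff₀ hp]; linarith
  have h2 : 1 / p ≤ n := by rw [div_le_iff₀ hp]; linarith
  have h3 := Real.log_pos h1
  have h4 : Real.log (1 / p) ≤ Real.log n := Real.log_le_log (by linarith) h2
  refine Nat.le_floor ?_
  rw [le_div_iff₀ (by positivity)]
  push_cast
  linarith

lemma three_mul_ceil_le_exp {n : ℕ} {a : ℝ} (ha : 0 ≤ a) (hn : 6 * a + 3 ≤ n) :
    3 * (⌈a * n⌉₊ : ℝ) ≤ Real.exp n := by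
  have h1 := Real.quadratic_le_exp_of_nonneg (n.cast_nonneg : (0 : ℝ) ≤ n)
  have h2 := Nat.ceil_lt_add_one (by positivity : 0 ≤ a * n)
  nlinarith

lemma one_le_floor_of_mem_RVectors {n : ℕ} {p r ρ C₀ Cτ : ℝ} {x : Fin n → ℝ}
    (hx : x ∈ RVectors n p r ρ C₀ Cτ) : 1 ≤ ⌊r * n⌋₊ := by
  obtain ⟨k, -, -, hx⟩ := hx
  have h1 : rearr x ⌊r * n⌋₊ = 1 := hx.elim (fun h => h.1.1.1) fun h => h.1.1
  by_contra! h
  rw [rearr, dif_neg (by omega)] at h1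
  norm_num at h1

end BernoulliMatrix

/-! ### Choice of the constants and conclusion -/

theorem theorem6p2 :
    ∃ C₀ : ℝ, IsAnticoncentrationConst C₀ ∧
    ∀ Cτ : ℝ, 0 < Cτ →
    ∃ r₀ ρ₀ C : ℝ, 0 < r₀ ∧ r₀ < 1 ∧ 0 < ρ₀ ∧ ρ₀ < 1 ∧ 0 < C ∧
    ∀ r ρ : ℝ, 0 < r → r ≤ r₀ → 0 < ρ → ρ ≤ ρ₀ →
    ∀ (n : ℕ) (p : unitInterval), 1 ≤ n → 0 < (p : ℝ) → (p : ℝ) ≤ 0.001 →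
      C * Real.log n ≤ (p : ℝ) * n →
      (matrixLaw n p).real
          {M | ∃ x ∈ RVectors n (p : ℝ) r ρ C₀ Cτ,
            l2 (toMat M *ᵥ x) ≤ √(p : ℝ) * n / (12 * C₀)}
        ≤ Real.exp (-2 * n) + Real.exp (-200 * ((p : ℝ) * n)) := by
  obtain ⟨L, hL1, hL⟩ := exists_smallBall (s := 60) (by norm_num)
  have hexp : ∀ n : ℕ, Real.exp ((1 - 60 / 2) * (n : ℝ)) = Real.exp (-29 * n) := by
    intro n; norm_num
  -- The factor `10` is the loss in spreadness under rounding: net points are spread with constant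
  -- `C₀/10 = L`.
  refine ⟨10 * L, isAnticoncentrationConst_of_smallBall (by linarith)
    fun n p hp A x lam hl hA hx => ?_, fun Cτ hCτ => ?_⟩
  · obtain ⟨h1, h2⟩ := hL (10 * L) (by linarith) n p hp A x lam hl hA hx
    refine ⟨h1.trans ?_, fun c => (h2 c).trans ?_⟩
    · rw [hexp, Real.exp_le_exp]
      have : (0 : ℝ) ≤ n := n.cast_nonneg
      linarith
    · rw [Real.exp_le_exp]; norm_num
  set ε : ℝ := 1 / (16 * (10 * L)) with hε
  have hε0 : 0 < ε := by positivity
  have hε1 : ε < 1 := by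
    rw [hε, div_lt_one (by positivity)]; linarith
  set A := 1 + Real.log (2 + 1 / ε ^ 2) with hA
  have hA0 : 0 < A := by
    have : 0 ≤ Real.log (2 + 1 / ε ^ 2) :=
      Real.log_nonneg (by linarith [(by positivity : 0 ≤ 1 / ε ^ 2)])
    linarith
  obtain ⟨d₀, hd₀1, hd₀⟩ := exists_log_threshold (Real.log (3 / ε) + Real.log (1 + Cτ ^ 2))
  have hN0 : 0 < 6 * (1 + Cτ) ^ 2 + 3 := by positivity
  -- In `r₀`: `2ε` serves `R_k^2`, `1/A` the entropy of `S`, and the last bound forces `n` to be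
  -- large, since `R` is empty unless `rn ≥ 1`. As `log n ≥ 1` then, `d₀ + 8` yields both `d ≥ d₀`
  -- and `d ≥ 8 log n`.
  refine ⟨min (min (1 / 2) (2 * ε)) (min (1 / A) (1 / (6 * (1 + Cτ) ^ 2 + 3))), ε, d₀ + 8,
    by positivity, lt_of_le_of_lt ((min_le_left _ _).trans (min_le_left _ _)) (by norm_num), hε0,
    hε1, by linarith, fun r ρ hr hr₀ _ hρ n p hn hp hp1 hnp => ?_⟩
  rw [le_min_iff, le_min_iff, le_min_iff] at hr₀
  obtain ⟨⟨-, hrε⟩, hrA, hrN⟩ := hr₀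
  rcases Set.eq_empty_or_nonempty (RVectors n (p : ℝ) r ρ (10 * L) Cτ) with hR | ⟨x, hx⟩
  · rw [hR]
    simp only [Set.mem_empty_iff_false, false_and, exists_false, Set.ofPred_false,
      measureReal_empty]
    positivity
  have hrn : 1 ≤ r * n := (Nat.one_le_floor_iff _).1 (one_le_floor_of_mem_RVectors hx)
  have hnN : 6 * (1 + Cτ) ^ 2 + 3 ≤ (n : ℝ) := by
    rw [le_div_iff₀ hN0] at hrN
    by_contra! h
    nlinarith [mul_lt_mul_of_pos_left h hr]
  have hlogn : 1 ≤ Real.log n := by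
    rw [Real.le_log_iff_exp_le (by linarith)]
    linarith [Real.exp_one_lt_d9, (by positivity : 0 ≤ 6 * (1 + Cτ) ^ 2)]
  have hdd₀ : d₀ ≤ p * n := by nlinarith
  have h8 : 8 * Real.log n ≤ p * n := by nlinarith
  have hd : 1 ≤ (p : ℝ) * n := hd₀1.trans hdd₀
  have hp1' : (p : ℝ) < 1 := lt_of_le_of_lt hp1 (by norm_num)
  obtain ⟨hy0, hy1, hy2⟩ := hd₀ _ hdd₀
  refine measureReal_exists_RVectors_le hn hp hp1 hd (by linarith) hCτ hr hrε hρ ?_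
    (two_le_ell0 hp hp1' hd h8) (fun k hk => ?_) (three_mul_ceil_le_exp (by positivity) hnN)
    fun B x lam hlam hB => ?_
  · rwa [le_div_iff₀ hA0] at hrA
  · exact head_le hp hp1'.le hd (by positivity) rfl hy0 hy1 hy2 hk
  · rw [← hexp]
    rw [mul_div_cancel_left₀ L (by norm_num : (10 : ℝ) ≠ 0)] at hB
    exact (hL L le_rfl n p (hp1.trans (by norm_num)) B x lam hlam hB.1 hB.2).1
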